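/- Let $\mathbb R^3_1$ be $\mathbb R^3$ with $\langle a,b\rangle=-a_1b_1+a_2b_2+a_3b_3$ and the Lorentzian cross product $a\boxtimes b=(a_3b_2-a_2b_3,\;a_3b_1-a_1b_3,\;a_1b_2-a_2b_1)$. For $c<0$ let $\mathbb H^2(c)=\{x\in\mathbb R^3_1 : \langle x,x\rangle=1/c,\ x_1>0\}$ and write $\mathbb H^2=\mathbb H^2(-1)$, with complex structure $(J_{\mathbb H^2})_xv=x\boxtimes v$ and Kähler form $\omega_{\mathbb H^2}=\langle J_{\mathbb H^2}\,\cdot,\cdot\rangle$. Equip $\mathbb H^2\times\mathbb H^2$ with the product metric and the complex structure $J=(J_{\mathbb H^2},-J_{\mathbb H^2})$, with Kähler form $\omega=\langle J\cdot,\cdot\rangle$. Its isometries are the maps $(x_1,x_2)\mapsto(A_1x_1,A_2x_2)$ and $(x_1,x_2)\mapsto(B_1x_2,B_2x_1)$ with $A_i,B_i$ in the orthochronous Lorentz group $\mathrm O^+(1,2)$; an isometry is called holomorphic (anti-holomorphic) if its differential commutes (anticommutes) with $J$. **Theorem.** Let $\Sigma$ be a connected smooth surface and let $\Phi=(\phi_1,\phi_2):\Sigma\to\mathbb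 H^2\times\mathbb H^2$ be a smooth Lagrangian immersion, that is, an immersion with $\Phi^*\omega=0$. Let $\omega_\Sigma$ be an area form on $\Sigma$ compatible with the metric induced by $\Phi$, i.e. with value $\pm1$ on every orthonormal basis of every tangent plane (the sign may be chosen independently at each point, so $\Sigma$ need not be orientable). Then there is a unique function $\Gamma:\Sigma\to\mathbb R$ with $$\phi_1^*\omega_{\mathbb H^2}=\phi_2^*\omega_{\mathbb H^2}=\Gamma\,\omega_\Sigma ,$$ and it satisfies $0\le\Gamma^2\le\frac14$. Moreover: (a) $\Gamma^2\equiv0$ if and only if $\Phi$ is locally a product of curves: every point of $\Sigma$ has an open neighbourhood $U$ such that $\Phi(U)=\{(\beta_1(s_1),\beta_2(s_2)) : s_1\in I_1,\ s_2\in I_2\}$ for some nonempty open intervals $I_1,I_2\subseteq\mathbb R$ and smooth curves $\beta_j:I_j\to\mathbb H^2$ parametrized by arc length. In particular, $\Gamma^2\equiv0$ whenever the whole image $\Phi(\Sigma)$ is contained in such a product of two curves. (b) $\Gamma^2\equiv\frac14$ if and only if there is a holomorphic or anti-holomorphic isometry $T$ of $\mathbb H^2\times\mathbb H^2$ such that $T(\Phi(\Sigma))$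 is an open part of the diagonal, i.e. $T(\Phi(\Sigma))=\{\tfrac1{\sqrt2}(x,x) : x\in U\}$ for a relatively open set $U\subseteq\mathbb H^2(-1/2)$. -/

import Mathlib

open scoped Manifold ContDiff
open Set

noncomputable section

namespace LagHH

/-- The vector space underlying Minkowski three-space. Only its vector space structure and its
topology are used; the scalar product is `mink`. -/
abbrev V : Type := Fin 3 → ℝ

/-- The vector space underlying `ℝ⁶` with a scalar product of index two. -/
abbrev W : Type := V × V

/-- The Lorentzian scalar product `-a₁b₁ + a₂b₂ + a₃b₃`. -/
def mink (a b : V) : ℝ := -(a 0 * b 0) + a 1 * b 1 + a 2 * b 2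

/-- The Lorentzian cross product
`a ⊠ b = (a₃b₂ - a₂b₃, a₃b₁ - a₁b₃, a₁b₂ - a₂b₁)`. -/
def cross (a b : V) : V :=
  ![a 2 * b 1 - a 1 * b 2, a 2 * b 0 - a 0 * b 2, a 0 * b 1 - a 1 * b 0]

/-- The hyperbolic plane of constant curvature `c < 0` (hyperboloid model). -/
def H2 (c : ℝ) : Set V := {x | mink x x = 1 / c ∧ 0 < x 0}

/-- The complex structure of `H2 c` at `x`, applied to a tangent vector `v`. -/
def JH (c : ℝ) (x v : V) : V := Real.sqrt (-c) • cross x v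

/-- The Kähler form of `H2 c` at `x`. -/
def omegaH (c : ℝ) (x v w : V) : ℝ := mink (JH c x v) w

/-- The product of two hyperbolic planes of curvature `-1`. -/
def HH : Set W := H2 (-1) ×ˢ H2 (-1)

/-- The tangent space of `HH` at `x`. -/
def tangentHH (x : W) : Set W := {v | mink x.1 v.1 = 0 ∧ mink x.2 v.2 = 0}

/-- The product metric. -/
def metricHH (v w : W) : ℝ := mink v.1 w.1 + mink v.2 w.2

/-- The complex structure `J = (J, -J)` of `HH` at `x`. -/
def JHH (x v : W) : W := (JH (-1) x.1 v.1, -JH (-1) x.2 v.2)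

/-- The Kähler form `⟨J ·, ·⟩` of `HH` at `x`. -/
def omegaHH (x v w : W) : ℝ := metricHH (JHH x v) w

/-- The orthochronous Lorentz group. -/
def IsOrthochronous (A : Matrix (Fin 3) (Fin 3) ℝ) : Prop :=
  (∀ a b : V, mink (A.mulVec a) (A.mulVec b) = mink a b) ∧ 0 < A 0 0

/-- The isometries of `HH`: the maps `(x₁, x₂) ↦ (A x₁, B x₂)` and `(x₁, x₂) ↦ (A x₂, B x₁)`
with `A`, `B` orthochronous Lorentz transformations. They are written as linear maps of the
ambient space, so that each of them is its own differential. -/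
def IsIsometryHH (T : W →ₗ[ℝ] W) : Prop :=
  ∃ A B : Matrix (Fin 3) (Fin 3) ℝ, IsOrthochronous A ∧ IsOrthochronous B ∧
    ((∀ x : W, T x = (A.mulVec x.1, B.mulVec x.2)) ∨
      (∀ x : W, T x = (A.mulVec x.2, B.mulVec x.1)))

/-- `T` is an isometry of `HH` whose differential commutes with `J`. -/
def IsHolomorphicIsometry (T : W →ₗ[ℝ] W) : Prop :=
  IsIsometryHH T ∧ ∀ x ∈ HH, ∀ v ∈ tangentHH x, T (JHH x v) = JHH (T x) (T v)

/-- `T` is an isometry of `HH` whose differential anticommutes with `J`. -/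
def IsAntiholomorphicIsometry (T : W →ₗ[ℝ] W) : Prop :=
  IsIsometryHH T ∧ ∀ x ∈ HH, ∀ v ∈ tangentHH x, T (JHH x v) = -JHH (T x) (T v)

/-- `β` restricted to the nonempty open interval `I` is a smooth curve in the hyperbolic plane
of curvature `-1`, parametrized by arc length. -/
structure IsUnitSpeedCurve (I : Set ℝ) (β : ℝ → V) : Prop where
  isOpen : IsOpen I
  ordConnected : I.OrdConnected
  nonempty : I.Nonempty
  smooth : ContDiffOn ℝ ∞ β I
  mem : ∀ s ∈ I, β s ∈ H2 (-1)
  unitSpeed : ∀ s ∈ I, mink (deriv β s) (deriv β s) = 1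

/-- `M` is the image of `(s₁, s₂) ↦ (β₁ s₁, β₂ s₂)` on `I₁ × I₂`, for two unit speed curves. -/
def IsProductOfCurves (M : Set W) : Prop :=
  ∃ (I₁ I₂ : Set ℝ) (β₁ β₂ : ℝ → V), IsUnitSpeedCurve I₁ β₁ ∧ IsUnitSpeedCurve I₂ β₂ ∧
    M = (fun s : ℝ × ℝ => (β₁ s.1, β₂ s.2)) '' (I₁ ×ˢ I₂)

/-- The diagonal `x ↦ (x, x) / √2` (to be applied to points of `H2 (-1/2)`). -/
def diagonal (x : V) : W := (1 / Real.sqrt 2) • (x, x)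

/-- `M` is an open part of the image of the diagonal immersion of `H2 (-1/2)`. -/
def IsOpenPartOfDiagonal (M : Set W) : Prop :=
  ∃ O : Set V, IsOpen O ∧ M = diagonal '' (O ∩ H2 (-1 / 2))

section Surface

variable {S : Type*} [TopologicalSpace S] [ChartedSpace (EuclideanSpace ℝ (Fin 2)) S]

/-- The tangent plane of the surface `S` at `p`. -/
abbrev Tan (p : S) : Type := TangentSpace 𝓘(ℝ, EuclideanSpace ℝ (Fin 2)) p

/-- The differential at `p` of a map from `S` to a normed space. -/
def diff {F : Type*} [NormedAddCommGroup F] [NormedSpace ℝ F] (f : S → F) (p : S) :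
    Tan p →L[ℝ] F :=
  mfderiv 𝓘(ℝ, EuclideanSpace ℝ (Fin 2)) 𝓘(ℝ, F) f p

/-- `Φ` is a smooth Lagrangian immersion of `S` into `HH`. -/
structure IsLagrangianImmersion (Φ : S → W) : Prop where
  smooth : ContMDiff 𝓘(ℝ, EuclideanSpace ℝ (Fin 2)) 𝓘(ℝ, W) ∞ Φ
  mem : ∀ p, Φ p ∈ HH
  immersion : ∀ p, Function.Injective (diff Φ p)
  lagrangian : ∀ p, ∀ u v : Tan p, omegaHH (Φ p) (diff Φ p u) (diff Φ p v) = 0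

/-- The metric on `S` induced by `Φ`. -/
def inducedMetric (Φ : S → W) (p : S) (u v : Tan p) : ℝ :=
  metricHH (diff Φ p u) (diff Φ p v)

/-- `area` is at every point `p` an area form of the tangent plane compatible with the induced metric:
it is `1` or `-1` on each orthonormal basis. The sign at each point is arbitrary, so that such a form
exists on every surface, orientable or not; all smooth compatible area forms are among them. -/
def IsCompatibleAreaForm (Φ : S → W) (area : ∀ p : S, (Tan p) [⋀^Fin 2]→ₗ[ℝ] ℝ) : Prop :=
  ∀ p, ∀ u v : Tan p, inducedMetric Φ p u u = 1 → inducedMetric Φ p v v = 1 →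
    inducedMetric Φ p u v = 0 → |area p ![u, v]| = 1

/-- The pull-back `φ^* ω` of the Kähler form of the hyperbolic plane of curvature `-1`. -/
def pullbackOmega (φ : S → V) (p : S) (u v : Tan p) : ℝ :=
  omegaH (-1) (φ p) (diff φ p u) (diff φ p v)

/-- `φ₁^* ω = φ₂^* ω = Γ area` for the two components `φ₁`, `φ₂` of `Φ`. -/
def IsGamma (Φ : S → W) (area : ∀ p : S, (Tan p) [⋀^Fin 2]→ₗ[ℝ] ℝ) (Γ : S → ℝ) : Prop :=
  ∀ p, ∀ u v : Tan p,
    pullbackOmega (fun q => (Φ q).1) p u v = Γ p * area p ![u, v] ∧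
    pullbackOmega (fun q => (Φ q).2) p u v = Γ p * area p ![u, v]

end Surface

end LagHH

end

open LagHH

noncomputable section

namespace LagHH

/-! Because `J` is the complex structure on the first factor and its negative on the second, the
Lagrangian condition says exactly that both components pull the area form back to the same 2-form
(`omegaHH_eq`); this form is `Γ` times the area form.

Fix an orthonormal basis of a tangent plane and let G₁, G₂ be the Gram matrices of the two
components. Then G₁ + G₂ = 1, and det G₁ = det G₂ = Γ² since the squared Kähler form is the Gram
determinant (`omega_sq`). Equal determinants force tr G₁ = 1 (`LagPlane.gram`). With diagonal
entries a, 1 - a and off-diagonal entry b this gives Γ² = 1/4 - (a - 1/2)² - b². Hence Γ² ≤ 1/4,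
with equality iff G₁ = G₂, that is, iff both components induce the same metric.

If Γ vanishes, each differential has rank one. One coordinate of each component together form a
chart in which each component depends on one variable only, and arc length parametrization finishes
(`exists_isProductOfCurves`). Conversely, if Γ were nonzero somewhere, a component would be locally
open, whereas a smooth curve has dense complement in the plane
(`omega_eq_zero_of_image_subset_curve`).

If Γ² = 1/4, the cones over the two components are related by a local isometry of Minkowski space,
which is affine; so φ₂ = Lφ₁ locally with L Lorentzian (`exists_local_linear_isometry`), and
globally by connectedness. Equality of the two pulled back forms gives det L = 1, so (L, id) is a
holomorphic isometry taking the image to the diagonal. For the converse any isometry will do, as it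
preserves the metric on each factor. -/

/-- The model space of surfaces. -/
abbrev E2 : Type := EuclideanSpace ℝ (Fin 2)

/-! ### Algebra of the Lorentzian product and the tangent planes of the hyperbolic plane -/

lemma omegaH_eq (x v w : V) : omegaH (-1) x v w = mink (cross x v) w := by
  simp [omegaH, JH]

lemma mink_comm (a b : V) : mink a b = mink b a := by simp only [mink]; ring

lemma mink_add_left (a b c : V) : mink (a + b) c = mink a c + mink b c := by
  simp only [mink, Pi.add_apply]; ring

lemma mink_add_right (a b c : V) : mink a (b + c) = mink a b + mink a c := by
  simp only [mink, Pi.add_apply]; ring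

lemma mink_sub_left (a b c : V) : mink (a - b) c = mink a c - mink b c := by
  simp only [mink, Pi.sub_apply]; ring

lemma mink_smul_left (r : ℝ) (a b : V) : mink (r • a) b = r * mink a b := by
  simp only [mink, Pi.smul_apply, smul_eq_mul]; ring

lemma mink_smul_right (r : ℝ) (a b : V) : mink a (r • b) = r * mink a b := by
  simp only [mink, Pi.smul_apply, smul_eq_mul]; ring

lemma mink_zero_left (a : V) : mink 0 a = 0 := by simp [mink]

lemma mink_zero_right (a : V) : mink a 0 = 0 := by simp [mink]

/-- The triple product is the determinant with rows `x`, `v`, `w`; the signs in `cross` and `mink`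
are matched for this. -/
lemma mink_cross (x v w : V) : mink (cross x v) w =
    x 0 * (v 1 * w 2 - v 2 * w 1) - x 1 * (v 0 * w 2 - v 2 * w 0) +
      x 2 * (v 0 * w 1 - v 1 * w 0) := by
  simp [mink, cross]; ring

lemma eq_zero_of_mink_eq_zero {a : V} (h : ∀ b, mink a b = 0) : a = 0 := by
  have h0 := h ![1, 0, 0]
  have h1 := h ![0, 1, 0]
  have h2 := h ![0, 0, 1]
  simp [mink] at h0 h1 h2
  ext i; fin_cases i <;> simpa

lemma mem_H2_neg_one {x : V} (hx : x ∈ H2 (-1)) : mink x x = -1 ∧ 0 < x 0 := by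
  refine ⟨?_, hx.2⟩
  have := hx.1
  norm_num at this
  exact this

/-- The scalar product is nonnegative on the tangent planes of the hyperbolic plane. -/
lemma mink_self_nonneg {x v : V} (hx : x ∈ H2 (-1)) (hv : mink x v = 0) :
    0 ≤ mink v v := by
  obtain ⟨h1, h2⟩ := mem_H2_neg_one hx
  simp only [mink] at *
  -- Multiplying by x₀² allows v₀ to be eliminated through x₀v₀ = x₁v₁ + x₂v₂; with x₀² = 1 + x₁² +
  -- x₂² only a sum of squares remains.
  have : 0 ≤ (x 0) ^ 2 * (-(v 0 * v 0) + v 1 * v 1 + v 2 * v 2) := by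
    have e : x 0 * v 0 = x 1 * v 1 + x 2 * v 2 := by linarith
    have : (x 0) ^ 2 * (-(v 0 * v 0) + v 1 * v 1 + v 2 * v 2) =
      (v 1) ^ 2 + (v 2) ^ 2 + (x 1 * v 2 - x 2 * v 1) ^ 2 := by
      have e2 : (x 0) ^ 2 = 1 + x 1 ^ 2 + x 2 ^ 2 := by linarith
      have e3 : (x 0) ^ 2 * (v 0 * v 0) = (x 1 * v 1 + x 2 * v 2) ^ 2 := by rw [← e]; ring
      rw [mul_add, mul_add, mul_neg, e3, e2]; ring
    rw [this]; positivity
  exact nonneg_of_mul_nonneg_right this (by positivity)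

/-- The scalar product is definite on the tangent planes of the hyperbolic plane. -/
lemma eq_zero_of_mink_self {x v : V} (hx : x ∈ H2 (-1)) (hv : mink x v = 0)
    (h : mink v v = 0) : v = 0 := by
  obtain ⟨h1, h2⟩ := mem_H2_neg_one hx
  simp only [mink] at *
  have e : x 0 * v 0 = x 1 * v 1 + x 2 * v 2 := by linarith
  have this : (v 1) ^ 2 + (v 2) ^ 2 + (x 1 * v 2 - x 2 * v 1) ^ 2 = 0 := by
    have e2 : (x 0) ^ 2 = 1 + x 1 ^ 2 + x 2 ^ 2 := by linarith
    have e3 : (x 0) ^ 2 * (v 0 * v 0) = (x 1 * v 1 + x 2 * v 2) ^ 2 := by rw [← e]; ring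
    have e4 : (x 0) ^ 2 * (-(v 0 * v 0) + v 1 * v 1 + v 2 * v 2) = 0 := by rw [h, mul_zero]
    rw [mul_add, mul_add, mul_neg, e3, e2] at e4
    linarith
  have v1 : v 1 = 0 := by
    have := sq_nonneg (v 2); have := sq_nonneg (x 1 * v 2 - x 2 * v 1)
    exact pow_eq_zero_iff two_ne_zero |>.1 (le_antisymm (by linarith) (sq_nonneg _))
  have v2 : v 2 = 0 := by
    have := sq_nonneg (v 1); have := sq_nonneg (x 1 * v 2 - x 2 * v 1)
    exact pow_eq_zero_iff two_ne_zero |>.1 (le_antisymm (by linarith) (sq_nonneg _))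
  have v0 : v 0 = 0 := by
    rw [v1, v2] at e
    have : x 0 * v 0 = 0 := by linarith
    exact (mul_eq_zero.1 this).resolve_left h2.ne'
  ext i; fin_cases i <;> assumption

/-- The Kähler form is the area form: its square is the Gram determinant. -/
lemma omega_sq {x v w : V} (hx : x ∈ H2 (-1)) (hv : mink x v = 0) (hw : mink x w = 0) :
    omegaH (-1) x v w ^ 2 = mink v v * mink w w - mink v w ^ 2 := by
  have h1 := (mem_H2_neg_one hx).1
  -- The square of a determinant is minus the Gram determinant of its rows, because the scalar
  -- product itself has determinant -1.
  have key : omegaH (-1) x v w ^ 2 =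
      -(mink x x * (mink v v * mink w w - mink v w ^ 2)
        - mink x v * (mink x v * mink w w - mink v w * mink x w)
        + mink x w * (mink x v * mink v w - mink v v * mink x w)) := by
    rw [omegaH_eq, mink_cross]; simp only [mink]; ring
  rw [key, h1, hv, hw]; ring

/-- The Kähler form in the coordinates `x₂, x₃` of the hyperbolic plane. -/
lemma omega_coord {x v w : V} (hx : x ∈ H2 (-1)) (hv : mink x v = 0) (hw : mink x w = 0) :
    x 0 * omegaH (-1) x v w = v 1 * w 2 - v 2 * w 1 := by
  have h1 := (mem_H2_neg_one hx).1
  rw [omegaH_eq, mink_cross]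
  simp only [mink] at *
  linear_combination (v 1 * w 2 - v 2 * w 1) * (-h1) + (x 1 * w 2 - x 2 * w 1) * hv
    - (x 1 * v 2 - x 2 * v 1) * hw

/-- Zero area means equality in Cauchy–Schwarz, so `v` is a multiple of the nonzero vector `w`;
comparing the coordinates `i` shows that the multiple is zero. -/
lemma eq_zero_of_omega_eq_zero {x v w : V} (hx : x ∈ H2 (-1)) (hv : mink x v = 0)
    (hw : mink x w = 0) (h : omegaH (-1) x v w = 0) {i : Fin 3} (hvi : v i = 0)
    (hwi : w i ≠ 0) : v = 0 := by
  have hg := omega_sq hx hv hw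
  rw [h] at hg
  have hww : mink w w ≠ 0 := fun h0 => hwi (by rw [eq_zero_of_mink_self hx hw h0]; rfl)
  -- This tangent vector has square ⟨w,w⟩ times the Gram determinant, which is zero, so definiteness
  -- applies.
  have hz : mink w w • v - mink v w • w = 0 := by
    apply eq_zero_of_mink_self hx
    · simp only [mink, Pi.sub_apply, Pi.smul_apply, smul_eq_mul] at *
      linear_combination (-(w 0 * w 0) + w 1 * w 1 + w 2 * w 2) * hv -
        (-(v 0 * w 0) + v 1 * w 1 + v 2 * w 2) * hw
    · have : mink (mink w w • v - mink v w • w) (mink w w • v - mink v w • w)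
          = mink w w * (mink v v * mink w w - mink v w ^ 2) := by
        generalize hA : mink w w = A
        generalize hB : mink v w = B
        generalize hC : mink v v = C
        have : mink (A • v - B • w) (A • v - B • w) =
            A ^ 2 * mink v v - 2 * A * B * mink v w + B ^ 2 * mink w w := by
          simp only [mink, Pi.sub_apply, Pi.smul_apply, smul_eq_mul]; ring
        rw [this, hA, hB, hC]; ring
      rw [this, ← hg]; ring
  have hvw : mink v w = 0 := by
    have := congrFun hz i
    simp [hvi] at this
    exact this.resolve_right hwi
  rw [hvw, zero_smul, sub_zero] at hz
  exact (smul_eq_zero.1 hz).resolve_left hww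

/-! ### Lagrangian tangent planes -/

/-- `L` is an injective linear map onto a Lagrangian tangent plane of `HH` at `x`. -/
structure LagPlane (x : W) (L : E2 →ₗ[ℝ] W) : Prop where
  mem : x ∈ HH
  tangent : ∀ u, L u ∈ tangentHH x
  inj : Function.Injective L
  omega_eq : ∀ u v, omegaH (-1) x.1 (L u).1 (L v).1 = omegaH (-1) x.2 (L u).2 (L v).2

lemma omegaHH_eq (x v w : W) :
    omegaHH x v w = omegaH (-1) x.1 v.1 w.1 - omegaH (-1) x.2 v.2 w.2 := by
  simp only [omegaHH, metricHH, JHH, omegaH, mink, Pi.neg_apply]; ring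

lemma metricHH_add_left (a b c : W) : metricHH (a + b) c = metricHH a c + metricHH b c := by
  simp only [metricHH, Prod.fst_add, Prod.snd_add, mink_add_left]; ring

lemma metricHH_smul_left (r : ℝ) (a b : W) : metricHH (r • a) b = r * metricHH a b := by
  simp only [metricHH, Prod.smul_fst, Prod.smul_snd, mink_smul_left]; ring

lemma metricHH_comm (a b : W) : metricHH a b = metricHH b a := by
  simp only [metricHH, mink_comm]

namespace LagPlane

variable {x : W} {L : E2 →ₗ[ℝ] W}

lemma metric_pos (h : LagPlane x L) {u : E2} (hu : u ≠ 0) : 0 < metricHH (L u) (L u) := by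
  have h1 := mink_self_nonneg h.mem.1 (h.tangent u).1
  have h2 := mink_self_nonneg h.mem.2 (h.tangent u).2
  refine lt_of_le_of_ne (add_nonneg h1 h2) fun h0 => hu ?_
  have h0' : mink (L u).1 (L u).1 + mink (L u).2 (L u).2 = 0 := h0.symm
  have e1 := eq_zero_of_mink_self h.mem.1 (h.tangent u).1 (by linarith)
  have e2 := eq_zero_of_mink_self h.mem.2 (h.tangent u).2 (by linarith)
  exact h.inj (by rw [map_zero]; exact Prod.ext e1 e2)

/-- There is an orthonormal basis. -/
lemma exists_orthonormal (h : LagPlane x L) : ∃ e₁ e₂ : E2,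
    metricHH (L e₁) (L e₁) = 1 ∧ metricHH (L e₂) (L e₂) = 1 ∧ metricHH (L e₁) (L e₂) = 0 ∧
    ∀ u : E2, ∃ a b : ℝ, u = a • e₁ + b • e₂ := by
  set g : E2 → E2 → ℝ := fun u v => metricHH (L u) (L v) with hg
  have gpos : ∀ u, u ≠ 0 → 0 < g u u := fun u hu => h.metric_pos hu
  have gadd : ∀ a b c, g (a + b) c = g a c + g b c := fun a b c => by
    simp [hg, metricHH_add_left]
  have gsmul : ∀ (r : ℝ) a b, g (r • a) b = r * g a b := fun r a b => by
    simp [hg, metricHH_smul_left]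
  have gcomm : ∀ a b, g a b = g b a := fun a b => metricHH_comm _ _
  have gadd' : ∀ a b c, g c (a + b) = g c a + g c b := fun a b c => by
    rw [gcomm, gadd, gcomm a, gcomm b]
  have gsmul' : ∀ (r : ℝ) a b, g a (r • b) = r * g a b := fun r a b => by
    rw [gcomm, gsmul, gcomm]
  set f₁ : E2 := !₂[1, 0] with hf₁
  set f₂ : E2 := !₂[0, 1] with hf₂
  have hf1 : f₁ ≠ 0 := fun h0 => by simpa [hf₁] using congrArg (fun z : E2 => z 0) h0
  have hspan : ∀ u : E2, u = u 0 • f₁ + u 1 • f₂ := fun u => by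
    ext i; fin_cases i <;> simp [hf₁, hf₂]
  have p1 := gpos f₁ hf1
  -- Gram–Schmidt on the standard basis.
  set k : ℝ := g f₂ f₁ / g f₁ f₁ with hk
  set n : E2 := f₂ + (-k) • f₁ with hn
  have hn0 : n ≠ 0 := fun h0 => by
    simpa [hn, hf₁, hf₂] using congrArg (fun z : E2 => z 1) h0
  have p2 := gpos n hn0
  have hort : g f₁ n = 0 := by
    rw [hn, gadd', gsmul', gcomm f₁ f₂, hk]; field_simp; ring
  set r₁ := Real.sqrt (g f₁ f₁) with hr₁
  set r₂ := Real.sqrt (g n n) with hr₂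
  have r1p : 0 < r₁ := Real.sqrt_pos.2 p1
  have r2p : 0 < r₂ := Real.sqrt_pos.2 p2
  have s1 : g f₁ f₁ = r₁ * r₁ := (Real.mul_self_sqrt p1.le).symm
  have s2 : g n n = r₂ * r₂ := (Real.mul_self_sqrt p2.le).symm
  refine ⟨r₁⁻¹ • f₁, r₂⁻¹ • n, ?_, ?_, ?_, fun u => ?_⟩
  · change g _ _ = 1
    rw [gsmul, gsmul', s1]; field_simp
  · change g _ _ = 1
    rw [gsmul, gsmul', s2]; field_simp
  · change g _ _ = 0
    rw [gsmul, gsmul', hort]; simp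
  -- Substitute f₂ = n + k f₁ into u = u₀f₁ + u₁f₂ and undo the normalizations.
  · refine ⟨(u 0 + u 1 * k) * r₁, u 1 * r₂, ?_⟩
    rw [smul_smul, smul_smul, mul_assoc, mul_assoc, mul_inv_cancel₀ r1p.ne',
      mul_inv_cancel₀ r2p.ne', hn]
    conv_lhs => rw [hspan u]
    module

/-- In an orthonormal basis, both components have the same determinant and the traces of their
first fundamental forms equal `1`. -/
lemma gram (h : LagPlane x L) {e₁ e₂ : E2} (h₁ : metricHH (L e₁) (L e₁) = 1)
    (h₂ : metricHH (L e₂) (L e₂) = 1) (h₁₂ : metricHH (L e₁) (L e₂) = 0) :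
    mink (L e₁).1 (L e₁).1 + mink (L e₂).1 (L e₂).1 = 1 ∧
    omegaH (-1) x.1 (L e₁).1 (L e₂).1 ^ 2 =
      mink (L e₁).1 (L e₁).1 * mink (L e₂).1 (L e₂).1 - mink (L e₁).1 (L e₂).1 ^ 2 := by
  have g1 := omega_sq h.mem.1 (h.tangent e₁).1 (h.tangent e₂).1
  have g2 := omega_sq h.mem.2 (h.tangent e₁).2 (h.tangent e₂).2
  refine ⟨?_, g1⟩
  rw [← h.omega_eq, g1] at g2
  simp only [metricHH] at h₁ h₂ h₁₂
  -- The second Gram matrix is the identity minus the first, so equal determinants read ad - b² = (1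
  -- - a)(1 - d) - b², that is a + d = 1.
  have e1 : mink (L e₁).2 (L e₁).2 = 1 - mink (L e₁).1 (L e₁).1 := by linarith
  have e2 : mink (L e₂).2 (L e₂).2 = 1 - mink (L e₂).1 (L e₂).1 := by linarith
  have e3 : mink (L e₁).2 (L e₂).2 = - mink (L e₁).1 (L e₂).1 := by linarith
  rw [e1, e2, e3] at g2
  linarith

end LagPlane

/-! ### The function `Γ` at a single point -/

lemma omegaH_combination (x a b : V) (p q r s : ℝ) :
    omegaH (-1) x (p • a + q • b) (r • a + s • b) = (p * s - q * r) * omegaH (-1) x a b := by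
  simp only [omegaH_eq, mink_cross, Pi.add_apply, Pi.smul_apply, smul_eq_mul]; ring

/-- A 2-form on a plane changes by the determinant of the substitution, as `omegaH` does in
`omegaH_combination`. Hence the quotient of the two forms does not depend on the basis. -/
lemma alternating_combination {M : Type*} [AddCommGroup M] [Module ℝ M]
    (f : M [⋀^Fin 2]→ₗ[ℝ] ℝ) (a b : M) (p q r s : ℝ) :
    f ![p • a + q • b, r • a + s • b] = (p * s - q * r) * f ![a, b] := by
  have hadd : ∀ u v w : M, f ![u + v, w] = f ![u, w] + f ![v, w] := fun u v w => by
    simpa using f.map_vecCons_add ![w] u v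
  have hsmul : ∀ (c : ℝ) (u w : M), f ![c • u, w] = c * f ![u, w] := fun c u w => by
    simpa using f.map_vecCons_smul ![w] c u
  have hswap : ∀ u w : M, f ![u, w] = -f ![w, u] := fun u w => by
    have := f.map_swap ![w, u] (i := 0) (j := 1) (by simp)
    rw [← this]; congr 1; ext i; fin_cases i <;> simp
  have hself : ∀ u : M, f ![u, u] = 0 := fun u => by linarith [hswap u u]
  have hadd' : ∀ u v w : M, f ![w, u + v] = f ![w, u] + f ![w, v] := fun u v w => by
    rw [hswap, hadd, hswap u, hswap v]; ring
  have hsmul' : ∀ (c : ℝ) (u w : M), f ![w, c • u] = c * f ![w, u] := fun c u w => by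
    rw [hswap, hsmul, hswap u]; ring
  simp only [hadd, hadd', hsmul, hsmul', hself]
  rw [hswap b a]; ring

namespace LagPlane

variable {x : W} {L : E2 →ₗ[ℝ] W}

/-- Pointwise existence of `Γ`. -/
lemma exists_gamma (h : LagPlane x L) {area : E2 [⋀^Fin 2]→ₗ[ℝ] ℝ}
    (ha : ∀ u v : E2, metricHH (L u) (L u) = 1 → metricHH (L v) (L v) = 1 →
      metricHH (L u) (L v) = 0 → |area ![u, v]| = 1) :
    (∃ u v : E2, area ![u, v] ≠ 0) ∧
    ∃ γ : ℝ, ∀ u v, omegaH (-1) x.1 (L u).1 (L v).1 = γ * area ![u, v] := by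
  obtain ⟨e₁, e₂, h₁, h₂, h₁₂, hs⟩ := h.exists_orthonormal
  have h1 := ha e₁ e₂ h₁ h₂ h₁₂
  have hne : area ![e₁, e₂] ≠ 0 := fun h0 => by simp [h0] at h1
  refine ⟨⟨e₁, e₂, hne⟩, omegaH (-1) x.1 (L e₁).1 (L e₂).1 / area ![e₁, e₂], fun u v => ?_⟩
  obtain ⟨a, b, rfl⟩ := hs u
  obtain ⟨c, d, rfl⟩ := hs v
  rw [alternating_combination]
  simp only [map_add, map_smul, Prod.fst_add, Prod.smul_fst]
  rw [omegaH_combination]; field_simp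

variable {area : E2 [⋀^Fin 2]→ₗ[ℝ] ℝ} {γ : ℝ}

lemma gamma_spec (h : LagPlane x L)
    (ha : ∀ u v : E2, metricHH (L u) (L u) = 1 → metricHH (L v) (L v) = 1 →
      metricHH (L u) (L v) = 0 → |area ![u, v]| = 1)
    (hγ : ∀ u v, omegaH (-1) x.1 (L u).1 (L v).1 = γ * area ![u, v])
    {e₁ e₂ : E2} (h₁ : metricHH (L e₁) (L e₁) = 1)
    (h₂ : metricHH (L e₂) (L e₂) = 1) (h₁₂ : metricHH (L e₁) (L e₂) = 0) :
    γ ^ 2 = mink (L e₁).1 (L e₁).1 * (1 - mink (L e₁).1 (L e₁).1) -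
      mink (L e₁).1 (L e₂).1 ^ 2 := by
  obtain ⟨g1, g2⟩ := h.gram h₁ h₂ h₁₂
  have h1 := ha e₁ e₂ h₁ h₂ h₁₂
  have : area ![e₁, e₂] ^ 2 = 1 := by rw [← sq_abs, h1]; norm_num
  rw [hγ, mul_pow, this, mul_one] at g2
  rw [g2]
  have : mink (L e₂).1 (L e₂).1 = 1 - mink (L e₁).1 (L e₁).1 := by linarith
  rw [this]

lemma gamma_sq_le (h : LagPlane x L)
    (ha : ∀ u v : E2, metricHH (L u) (L u) = 1 → metricHH (L v) (L v) = 1 →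
      metricHH (L u) (L v) = 0 → |area ![u, v]| = 1)
    (hγ : ∀ u v, omegaH (-1) x.1 (L u).1 (L v).1 = γ * area ![u, v]) : γ ^ 2 ≤ 1 / 4 := by
  obtain ⟨e₁, e₂, h₁, h₂, h₁₂, -⟩ := h.exists_orthonormal
  rw [h.gamma_spec ha hγ h₁ h₂ h₁₂]
  nlinarith [sq_nonneg (mink (L e₁).1 (L e₁).1 - 1 / 2), sq_nonneg (mink (L e₁).1 (L e₂).1)]

lemma gamma_eq_zero_iff (h : LagPlane x L)
    (ha : ∀ u v : E2, metricHH (L u) (L u) = 1 → metricHH (L v) (L v) = 1 →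
      metricHH (L u) (L v) = 0 → |area ![u, v]| = 1)
    (hγ : ∀ u v, omegaH (-1) x.1 (L u).1 (L v).1 = γ * area ![u, v]) :
    γ ^ 2 = 0 ↔ ∀ u v, omegaH (-1) x.1 (L u).1 (L v).1 = 0 := by
  constructor
  · intro h0 u v
    rw [hγ, pow_eq_zero_iff two_ne_zero |>.1 h0, zero_mul]
  · intro h0
    obtain ⟨u, v, huv⟩ := (h.exists_gamma ha).1
    have := hγ u v
    rw [h0] at this
    rw [(mul_eq_zero.1 this.symm).resolve_right huv]; norm_num

/-- Since Γ² = 1/4 - (a - 1/2)² - b², the extreme value forces a = 1/2 and b = 0, so both Gram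
matrices are half the identity. -/
lemma gamma_eq_quarter_iff (h : LagPlane x L)
    (ha : ∀ u v : E2, metricHH (L u) (L u) = 1 → metricHH (L v) (L v) = 1 →
      metricHH (L u) (L v) = 0 → |area ![u, v]| = 1)
    (hγ : ∀ u v, omegaH (-1) x.1 (L u).1 (L v).1 = γ * area ![u, v]) :
    γ ^ 2 = 1 / 4 ↔ ∀ u v, mink (L u).1 (L v).1 = mink (L u).2 (L v).2 := by
  obtain ⟨e₁, e₂, h₁, h₂, h₁₂, hs⟩ := h.exists_orthonormal
  rw [h.gamma_spec ha hγ h₁ h₂ h₁₂]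
  have g1 := (h.gram h₁ h₂ h₁₂).1
  simp only [metricHH] at h₁ h₂ h₁₂
  constructor
  · intro h0 u v
    have q1 := sq_nonneg (mink (L e₁).1 (L e₁).1 - 1 / 2)
    have q2 := sq_nonneg (mink (L e₁).1 (L e₂).1)
    have z1 : mink (L e₁).1 (L e₁).1 - 1 / 2 = 0 :=
      pow_eq_zero_iff two_ne_zero |>.1 (le_antisymm (by linarith) q1)
    have z2 : mink (L e₁).1 (L e₂).1 = 0 :=
      pow_eq_zero_iff two_ne_zero |>.1 (le_antisymm (by linarith) q2)
    obtain ⟨a, b, rfl⟩ := hs u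
    obtain ⟨c, d, rfl⟩ := hs v
    simp only [map_add, map_smul, Prod.fst_add, Prod.smul_fst, Prod.snd_add, Prod.smul_snd,
      mink_add_left, mink_add_right, mink_smul_left, mink_smul_right]
    rw [mink_comm (L e₂).1 (L e₁).1, mink_comm (L e₂).2 (L e₁).2,
      show mink (L e₁).1 (L e₁).1 = mink (L e₁).2 (L e₁).2 by linarith,
      show mink (L e₁).1 (L e₂).1 = mink (L e₁).2 (L e₂).2 by linarith,
      show mink (L e₂).1 (L e₂).1 = mink (L e₂).2 (L e₂).2 by linarith]
  · intro h0
    have a1 : mink (L e₁).1 (L e₁).1 = 1 / 2 := by have := h0 e₁ e₁; linarith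
    have a2 : mink (L e₁).1 (L e₂).1 = 0 := by have := h0 e₁ e₂; linarith
    rw [a1, a2]; norm_num

lemma comp (h : LagPlane x L) {M : E2 →ₗ[ℝ] E2} (hM : Function.Injective M) :
    LagPlane x (L ∘ₗ M) :=
  ⟨h.mem, fun _ => h.tangent _, h.inj.comp hM, fun _ _ => h.omega_eq _ _⟩

end LagPlane

open Filter Topology

/-! ### Inverse functions -/

section InverseFunction

variable {E F : Type*} [NormedAddCommGroup E] [NormedSpace ℝ E] [NormedAddCommGroup F]
  [NormedSpace ℝ F]

/-- Inverse function theorem, with an inverse that is smooth on the whole target. -/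
lemma exists_smooth_inverse [CompleteSpace E] {f : E → F} {U : Set E} (hU : IsOpen U)
    (hf : ContDiffOn ℝ ∞ f U) {x : E} (hx : x ∈ U) {f' : E ≃L[ℝ] F}
    (hf' : HasFDerivAt f (f' : E →L[ℝ] F) x) :
    ∃ e : OpenPartialHomeomorph E F, x ∈ e.source ∧ e.source ⊆ U ∧ (∀ y, e y = f y) ∧
      ContDiffOn ℝ ∞ e.symm e.target := by
  have hfx : ContDiffAt ℝ ∞ f x := hf.contDiffAt (hU.mem_nhds hx)
  have hn : (∞ : WithTop ℕ∞) ≠ 0 := by simp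
  set e₀ := hfx.toOpenPartialHomeomorph f hf' hn
  -- Invertibility of the derivative is an open condition. Restricting to where it holds makes the
  -- inverse smooth at every point of the target, and not only at the image of `x`.
  have hN : IsOpen (U ∩ fderiv ℝ f ⁻¹' range ((↑) : (E ≃L[ℝ] F) → E →L[ℝ] F)) :=
    (hf.continuousOn_fderiv_of_isOpen hU (by simp)).isOpen_inter_preimage hU
      ContinuousLinearEquiv.isOpen
  refine ⟨e₀.restrOpen _ hN, ?_, ?_, fun y => rfl, fun y hy => ?_⟩
  · rw [OpenPartialHomeomorph.restrOpen_source]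
    refine ⟨hfx.mem_toOpenPartialHomeomorph_source hf' hn, hx, f', ?_⟩
    exact hf'.fderiv.symm
  · rw [OpenPartialHomeomorph.restrOpen_source]
    exact fun y hy => hy.2.1
  · have hy' := (e₀.restrOpen _ hN).map_target hy
    rw [OpenPartialHomeomorph.restrOpen_source] at hy'
    obtain ⟨-, hyU, g', hg'⟩ := hy'
    have hfy : ContDiffAt ℝ ∞ f ((e₀.restrOpen _ hN).symm y) := hf.contDiffAt (hU.mem_nhds hyU)
    refine (OpenPartialHomeomorph.contDiffAt_symm (f₀' := g') _ hy ?_ hfy).contDiffWithinAt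
    rw [hg']
    exact (hfy.differentiableAt hn).hasFDerivAt

/-- An injective linear map between spaces of the same dimension is an equivalence. -/
lemma exists_continuousLinearEquiv [FiniteDimensional ℝ E] [FiniteDimensional ℝ F]
    (h : Module.finrank ℝ E = Module.finrank ℝ F) {L : E →L[ℝ] F}
    (hL : ∀ v, L v = 0 → v = 0) : ∃ e : E ≃L[ℝ] F, (e : E →L[ℝ] F) = L := by
  have hi : Function.Injective (L : E →ₗ[ℝ] F) := (injective_iff_map_eq_zero _).2 hL
  refine ⟨(LinearMap.linearEquivOfInjective _ hi h).toContinuousLinearEquiv, ?_⟩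
  ext v; rfl

end InverseFunction

/-! ### Maps into the hyperbolic plane and their rigidity -/

lemma hasDerivAt_mink {a b : ℝ → V} {a' b' : V} {t : ℝ} (ha : HasDerivAt a a' t)
    (hb : HasDerivAt b b' t) :
    HasDerivAt (fun s => mink (a s) (b s)) (mink a' (b t) + mink (a t) b') t := by
  rw [hasDerivAt_pi] at ha hb
  have := (((ha 0).mul (hb 0)).neg.add ((ha 1).mul (hb 1))).add ((ha 2).mul (hb 2))
  refine this.congr_deriv ?_
  unfold mink; ring

lemma contDiff_mink : ContDiff ℝ ∞ (fun p : V × V => mink p.1 p.2) := by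
  unfold mink; fun_prop

/-- The derivative of a map into the hyperbolic plane is tangent to it. -/
lemma mink_fderiv_eq_zero {E : Type*} [NormedAddCommGroup E] [NormedSpace ℝ E] {g : E → V}
    {g' : E →L[ℝ] V} {u : E} (hg : HasFDerivAt g g' u) (hm : ∀ᶠ z in 𝓝 u, g z ∈ H2 (-1))
    (v : E) : mink (g u) (g' v) = 0 := by
  have hline : HasDerivAt (fun t : ℝ => u + t • v) v 0 := by
    simpa using ((hasDerivAt_id (0 : ℝ)).smul_const v).const_add u
  have hc : HasDerivAt (fun t : ℝ => g (u + t • v)) (g' v) 0 := by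
    have hg0 : HasFDerivAt g g' (u + (0 : ℝ) • v) := by simpa using hg
    exact hg0.comp_hasDerivAt (0 : ℝ) hline
  have h1 := hasDerivAt_mink hc hc
  have h2 : (fun s : ℝ => mink (g (u + s • v)) (g (u + s • v))) =ᶠ[𝓝 0] fun _ => (-1 : ℝ) := by
    have : Tendsto (fun t : ℝ => u + t • v) (𝓝 0) (𝓝 u) := by
      simpa using hline.continuousAt.tendsto
    exact (this.eventually hm).mono fun t ht => (mem_H2_neg_one ht).1
  have h3 := h1.unique ((hasDerivAt_const (0 : ℝ) (-1 : ℝ)).congr_of_eventuallyEq h2)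
  simp only [zero_smul, add_zero] at h3
  rw [mink_comm (g' v)] at h3
  linarith

/-- A local isometry of Minkowski space has locally constant derivative. -/
lemma eventually_fderiv_eq {f : V → V} {O : Set V} (hO : IsOpen O) (hf : ContDiffOn ℝ ∞ f O)
    (hiso : ∀ y ∈ O, ∀ v w, mink (fderiv ℝ f y v) (fderiv ℝ f y w) = mink v w) {y : V}
    (hy : y ∈ O) : ∀ᶠ z in 𝓝 y, fderiv ℝ f z = fderiv ℝ f y := by
  have hD : DifferentiableOn ℝ (fderiv ℝ f) O :=
    (hf.fderiv_of_isOpen hO (m := 1) (by norm_cast)).differentiableOn (by simp)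
  have hz : ∀ z ∈ O, fderiv ℝ (fderiv ℝ f) z = 0 := by
    intro z hz
    have hDz : HasFDerivAt (fderiv ℝ f) (fderiv ℝ (fderiv ℝ f) z) z :=
      (hD.differentiableAt (hO.mem_nhds hz)).hasFDerivAt
    set D := fderiv ℝ f z with hDdef
    set D2 := fderiv ℝ (fderiv ℝ f) z with hD2
    have hsymm : ∀ u v, D2 u v = D2 v u :=
      ((hf.contDiffAt (hO.mem_nhds hz)).isSymmSndFDerivAt
        (by simpa using WithTop.coe_le_coe.2 (le_top : (2 : ℕ∞) ≤ ⊤)))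
    have hskew : ∀ u v w, mink (D2 u v) (D w) + mink (D v) (D2 u w) = 0 := by
      intro u v w
      have hline : HasDerivAt (fun t : ℝ => z + t • u) u 0 := by
        simpa using ((hasDerivAt_id (0 : ℝ)).smul_const u).const_add z
      have hc : ∀ v, HasDerivAt (fun t : ℝ => fderiv ℝ f (z + t • u) v) (D2 u v) 0 := by
        intro v
        have h0 : HasFDerivAt (fderiv ℝ f) D2 (z + (0 : ℝ) • u) := by simpa using hDz
        exact (ContinuousLinearMap.apply ℝ V v).hasFDerivAt.comp_hasDerivAt (0 : ℝ)
          (h0.comp_hasDerivAt (0 : ℝ) hline)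
      have h1 := hasDerivAt_mink (hc v) (hc w)
      have h2 : (fun s : ℝ => mink (fderiv ℝ f (z + s • u) v) (fderiv ℝ f (z + s • u) w))
          =ᶠ[𝓝 0] fun _ => mink v w := by
        have : Tendsto (fun t : ℝ => z + t • u) (𝓝 0) (𝓝 z) := by
          simpa using hline.continuousAt.tendsto
        exact (this.eventually (hO.mem_nhds hz)).mono fun t ht => hiso _ ht _ _
      have h3 := h1.unique ((hasDerivAt_const (0 : ℝ) (mink v w)).congr_of_eventuallyEq h2)
      simpa using h3
    -- A trilinear form symmetric in its first two arguments and skew in its last two vanishes.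
    have hT : ∀ u v w, mink (D2 u v) (D w) = 0 := by
      intro u v w
      have a1 := hskew u v w
      have a2 := hskew v w u
      have a3 := hskew w u v
      rw [mink_comm (D v)] at a1
      rw [mink_comm (D w)] at a2
      rw [mink_comm (D u)] at a3
      rw [hsymm u w] at a1
      rw [hsymm v u] at a2
      rw [hsymm w v] at a3
      linarith
    have hinj : ∀ v, D v = 0 → v = 0 := fun v hv => eq_zero_of_mink_eq_zero fun w => by
      rw [← hiso z hz, ← hDdef, hv, mink_zero_left]
    obtain ⟨e, he⟩ := exists_continuousLinearEquiv rfl hinj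
    ext1 u; ext1 v
    refine eq_zero_of_mink_eq_zero fun w => ?_
    have := hT u v (e.symm w)
    rw [← he] at this
    simpa using this
  obtain ⟨r, hr, hball⟩ := Metric.isOpen_iff.1 hO y hy
  filter_upwards [Metric.ball_mem_nhds y hr] with z hzr
  exact Metric.isOpen_ball.is_const_of_fderiv_eq_zero (convex_ball y r).isPreconnected
    (hD.mono hball) (fun w hw => hz w (hball hw)) hzr (Metric.mem_ball_self hr)

/-- Two local isometries of a surface into the hyperbolic plane with the same induced metric
differ locally by a linear isometry. -/
lemma exists_local_linear_isometry {O : Set E2} (hO : IsOpen O) {g₁ g₂ : E2 → V}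
    (hg₁ : ContDiffOn ℝ ∞ g₁ O) (hg₂ : ContDiffOn ℝ ∞ g₂ O) (hm₁ : ∀ u ∈ O, g₁ u ∈ H2 (-1))
    (hm₂ : ∀ u ∈ O, g₂ u ∈ H2 (-1)) (hinj : ∀ u ∈ O, ∀ v, fderiv ℝ g₁ u v = 0 → v = 0)
    (hiso : ∀ u ∈ O, ∀ v w, mink (fderiv ℝ g₁ u v) (fderiv ℝ g₁ u w) =
      mink (fderiv ℝ g₂ u v) (fderiv ℝ g₂ u w)) {u₀ : E2} (hu₀ : u₀ ∈ O) :
    ∃ L : V →L[ℝ] V, (∀ v w, mink (L v) (L w) = mink v w) ∧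
      ∀ᶠ u in 𝓝 u₀, g₂ u = L (g₁ u) := by
  have hU : IsOpen (O ×ˢ (univ : Set ℝ)) := hO.prod isOpen_univ
  have hd : ∀ {g : E2 → V}, ContDiffOn ℝ ∞ g O → ∀ u ∈ O, HasFDerivAt g (fderiv ℝ g u) u :=
    fun hg u hu => ((hg.contDiffAt (hO.mem_nhds hu)).differentiableAt (by simp)).hasFDerivAt
  -- Pass to the cone (u, t) ↦ t g(u), a map between spaces of dimension three. As g is normal to
  -- its derivatives, the metric of the cone is determined by the metric induced by g.
  have hcone : ∀ {g : E2 → V}, ContDiffOn ℝ ∞ g O →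
      ContDiffOn ℝ ∞ (fun p : E2 × ℝ => p.2 • g p.1) (O ×ˢ (univ : Set ℝ)) := fun hg =>
    contDiff_snd.contDiffOn.smul (hg.comp contDiff_fst.contDiffOn fun p hp => hp.1)
  have hconed : ∀ {g : E2 → V}, ContDiffOn ℝ ∞ g O → ∀ p : E2 × ℝ, p.1 ∈ O →
      ∃ D : E2 × ℝ →L[ℝ] V, HasFDerivAt (fun p : E2 × ℝ => p.2 • g p.1) D p ∧
        ∀ v, D v = p.2 • fderiv ℝ g p.1 v.1 + v.2 • g p.1 := by
    intro g hg p hp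
    exact ⟨_, (hasFDerivAt_snd (p := p)).smul ((hd hg _ hp).comp p hasFDerivAt_fst),
      fun v => by simp⟩
  have htan : ∀ {g : E2 → V}, ContDiffOn ℝ ∞ g O → (∀ u ∈ O, g u ∈ H2 (-1)) → ∀ u ∈ O, ∀ v,
      mink (g u) (fderiv ℝ g u v) = 0 := fun hg hm u hu v =>
    mink_fderiv_eq_zero (hd hg u hu) (by filter_upwards [hO.mem_nhds hu] using hm) v
  have hgram : ∀ {g : E2 → V}, ContDiffOn ℝ ∞ g O → (∀ u ∈ O, g u ∈ H2 (-1)) → ∀ u ∈ O,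
      ∀ (r : ℝ) (v w : E2 × ℝ),
      mink (r • fderiv ℝ g u v.1 + v.2 • g u) (r • fderiv ℝ g u w.1 + w.2 • g u) =
        r ^ 2 * mink (fderiv ℝ g u v.1) (fderiv ℝ g u w.1) - v.2 * w.2 := by
    intro g hg hm u hu r v w
    simp only [mink_add_left, mink_add_right, mink_smul_left, mink_smul_right]
    rw [mink_comm _ (g u), htan hg hm u hu, htan hg hm u hu, (mem_H2_neg_one (hm u hu)).1]
    ring
  obtain ⟨D₁, hD₁, hD₁'⟩ := hconed hg₁ (u₀, 1) hu₀
  have hD₁inj : ∀ v, D₁ v = 0 → v = 0 := by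
    intro v hv
    have h0 := hgram hg₁ hm₁ u₀ hu₀ 1 v (0, 1)
    rw [hD₁'] at hv
    simp only at hv
    rw [hv, mink_zero_left] at h0
    simp [mink_zero_right] at h0
    rw [h0, zero_smul, add_zero, one_smul] at hv
    exact Prod.ext (hinj u₀ hu₀ _ hv) h0
  obtain ⟨e', he'⟩ := exists_continuousLinearEquiv (by simp) hD₁inj
  rw [← he'] at hD₁
  obtain ⟨e, hxe, heU, hef, hsm⟩ := exists_smooth_inverse hU (hcone hg₁)
    (show (u₀, (1 : ℝ)) ∈ O ×ˢ (univ : Set ℝ) from ⟨hu₀, mem_univ _⟩) hD₁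
  -- `f` carries the cone over `g₁` to the cone over `g₂`; having equal cone metrics, it is a local
  -- isometry of Minkowski space.
  set f : V → V := fun y => (e.symm y).2 • g₂ (e.symm y).1 with hf
  have hfsm : ContDiffOn ℝ ∞ f e.target :=
    (hcone hg₂).comp hsm fun y hy => heU (e.map_target hy)
  have key : ∀ p ∈ e.source, ∀ v : E2 × ℝ,
      fderiv ℝ f (e p) (p.2 • fderiv ℝ g₁ p.1 v.1 + v.2 • g₁ p.1) =
        p.2 • fderiv ℝ g₂ p.1 v.1 + v.2 • g₂ p.1 := by
    intro p hp v
    have hpO := (heU hp).1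
    obtain ⟨A, hA, hA'⟩ := hconed hg₁ p hpO
    obtain ⟨B, hB, hB'⟩ := hconed hg₂ p hpO
    have hfd : HasFDerivAt f (fderiv ℝ f (e p)) (e p) :=
      ((hfsm.contDiffAt (e.open_target.mem_nhds (e.map_source hp))).differentiableAt
        (by simp)).hasFDerivAt
    have hA2 : HasFDerivAt e A p := hA.congr_of_eventuallyEq (Eventually.of_forall hef)
    have h1 := hfd.comp p hA2
    have h2 : f ∘ e =ᶠ[𝓝 p] fun p : E2 × ℝ => p.2 • g₂ p.1 := by
      filter_upwards [e.open_source.mem_nhds hp] with z hz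
      simp only [hf, Function.comp, e.left_inv hz]
    have h3 := (hB.congr_of_eventuallyEq h2).unique h1
    rw [← hA', ← hB', h3]; rfl
  have hsurj : ∀ y ∈ e.target, ∀ v : V, ∃ w : E2 × ℝ,
      v = (e.symm y).2 • fderiv ℝ g₁ (e.symm y).1 w.1 + w.2 • g₁ (e.symm y).1 := by
    intro y hy v
    obtain ⟨A, hA, hA'⟩ := hconed hg₁ (e.symm y) (heU (e.map_target hy)).1
    have hs : HasFDerivAt e.symm (fderiv ℝ e.symm y) y :=
      ((hsm.contDiffAt (e.open_target.mem_nhds hy)).differentiableAt (by simp)).hasFDerivAt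
    have hA2 : HasFDerivAt e A (e.symm y) := hA.congr_of_eventuallyEq (Eventually.of_forall hef)
    have h1 := hA2.comp y hs
    have h2 : e ∘ e.symm =ᶠ[𝓝 y] id := by
      filter_upwards [e.open_target.mem_nhds hy] with z hz
      exact e.right_inv hz
    have h3 := ((hasFDerivAt_id y).congr_of_eventuallyEq h2).unique h1
    refine ⟨fderiv ℝ e.symm y v, ?_⟩
    rw [← hA']
    have := congrArg (fun L : V →L[ℝ] V => L v) h3
    simpa using this
  have hfiso : ∀ y ∈ e.target, ∀ v w, mink (fderiv ℝ f y v) (fderiv ℝ f y w) = mink v w := by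
    intro y hy v w
    obtain ⟨v', rfl⟩ := hsurj y hy v
    obtain ⟨w', rfl⟩ := hsurj y hy w
    have hp := e.map_target hy
    have k := key _ hp
    rw [e.right_inv hy] at k
    rw [k, k, hgram hg₁ hm₁ _ (heU hp).1, hgram hg₂ hm₂ _ (heU hp).1, hiso _ (heU hp).1]
  have hev := eventually_fderiv_eq e.open_target hfsm hfiso (e.map_source hxe)
  refine ⟨fderiv ℝ f (e (u₀, 1)), hfiso _ (e.map_source hxe), ?_⟩
  have hc : ContinuousAt (fun u : E2 => (u, (1 : ℝ))) u₀ := by fun_prop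
  have hev2 := hc.eventually ((e.continuousAt hxe).eventually hev)
  filter_upwards [hev2, hc.eventually (e.open_source.mem_nhds hxe)] with u h1 h2
  -- The radial direction: the derivative of `f` maps `g₁ u` to `g₂ u`, and this derivative is the
  -- same for all nearby `u`.
  have := key _ h2 (0, 1)
  rw [h1] at this
  simpa using this.symm

/-! ### Openness where the pulled back area form is nonzero -/

/-- Projection of Minkowski space to the last two coordinates. -/
def planeProj : V →L[ℝ] ℝ × ℝ :=
  (ContinuousLinearMap.proj (R := ℝ) (φ := fun _ : Fin 3 => ℝ) 1).prod
    (ContinuousLinearMap.proj (R := ℝ) (φ := fun _ : Fin 3 => ℝ) 2)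

lemma planeProj_apply (v : V) : planeProj v = (v 1, v 2) := rfl

/-- Where the pull-back of the area form does not vanish, a map into the hyperbolic plane is open. -/
lemma planeProj_image_mem_nhds {g : E2 → V} {g' : E2 →L[ℝ] V} {u : E2}
    (hg : HasStrictFDerivAt g g' u) (hm : ∀ᶠ z in 𝓝 u, g z ∈ H2 (-1)) {v w : E2}
    (h : omegaH (-1) (g u) (g' v) (g' w) ≠ 0) {N : Set E2} (hN : N ∈ 𝓝 u) :
    (fun z => planeProj (g z)) '' N ∈ 𝓝 (planeProj (g u)) := by
  have hq : HasStrictFDerivAt (fun z => planeProj (g z)) (planeProj.comp g') u :=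
    planeProj.hasStrictFDerivAt.comp u hg
  have ht := mink_fderiv_eq_zero hg.hasFDerivAt hm
  have hc := omega_coord hm.self_of_nhds (ht v) (ht w)
  set d := g' v 1 * g' w 2 - g' v 2 * g' w 1 with hd
  have hd0 : d ≠ 0 := by
    rw [← hc]; exact mul_ne_zero (mem_H2_neg_one hm.self_of_nhds).2.ne' h
  have hsurj : (planeProj.comp g').range = ⊤ := by
    rw [LinearMap.range_eq_top]
    intro y
    -- Cramer's rule; the determinant `d` is nonzero by `omega_coord`.
    refine ⟨((y.1 * g' w 2 - y.2 * g' w 1) / d) • v + ((y.2 * g' v 1 - y.1 * g' v 2) / d) • w, ?_⟩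
    ext
    · simp [planeProj_apply]; field_simp; rw [hd]; ring
    · simp [planeProj_apply]; field_simp; rw [hd]; ring
  rw [← hq.map_nhds_eq_of_surj hsurj]
  exact image_mem_map hN

/-- A map into a curve pulls the area form back to zero. -/
lemma omega_eq_zero_of_image_subset_curve {g : E2 → V} {g' : E2 →L[ℝ] V} {u : E2}
    (hg : HasStrictFDerivAt g g' u) (hm : ∀ᶠ z in 𝓝 u, g z ∈ H2 (-1)) {I : Set ℝ} {β : ℝ → V}
    (hβ : IsUnitSpeedCurve I β) (h : ∀ᶠ z in 𝓝 u, g z ∈ β '' I) (v w : E2) :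
    omegaH (-1) (g u) (g' v) (g' w) = 0 := by
  by_contra h0
  have h1 := planeProj_image_mem_nhds hg hm h0 h
  -- A smooth image of a set of Hausdorff dimension at most one has dense complement in the plane,
  -- so it cannot contain a neighbourhood.
  have h2 : Dense ((fun s => planeProj (β s)) '' I)ᶜ := by
    have hc : ContDiffOn ℝ 1 (fun s => planeProj (β s)) I :=
      (planeProj.contDiff.comp_contDiffOn hβ.smooth).of_le (by norm_cast)
    refine hc.dense_compl_image_of_dimH_lt_finrank hβ.ordConnected.convex subset_rfl ?_
    calc dimH I ≤ dimH (univ : Set ℝ) := dimH_mono (subset_univ _)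
      _ = 1 := Real.dimH_univ
      _ < _ := by simp
  obtain ⟨y, hy1, hy2⟩ := h2.inter_nhds_nonempty h1
  obtain ⟨z, hz, rfl⟩ := hy2
  obtain ⟨s, hs, hsz⟩ := hz
  exact hy1 ⟨s, hs, congrArg planeProj hsz⟩

/-! ### Degenerate components: products of curves -/

/-- Local reparametrization by arc length. -/
lemma exists_unitSpeed_reparam {c : ℝ → V} {I : Set ℝ} (hI : IsOpen I) (hc : ContDiffOn ℝ ∞ c I)
    (hm : ∀ s ∈ I, c s ∈ H2 (-1)) {s₀ : ℝ} (hs₀ : s₀ ∈ I) (h0 : deriv c s₀ ≠ 0) :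
    ∃ I' ⊆ I, IsOpen I' ∧ s₀ ∈ I' ∧ ∃ (J : Set ℝ) (β : ℝ → V), IsUnitSpeedCurve J β ∧
      β '' J = c '' I' := by
  have hcd : ∀ s ∈ I, HasDerivAt c (deriv c s) s := fun s hs =>
    ((hc.contDiffAt (hI.mem_nhds hs)).differentiableAt (by simp)).hasDerivAt
  have hc' : ContDiffOn ℝ ∞ (deriv c) I :=
    ((contDiffOn_infty_iff_deriv_of_isOpen hI).1 hc).2
  have htan : ∀ s ∈ I, mink (c s) (deriv c s) = 0 := fun s hs => by
    have := mink_fderiv_eq_zero (hcd s hs).hasFDerivAt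
      (by filter_upwards [hI.mem_nhds hs] using hm) 1
    simpa using this
  set Q : ℝ → ℝ := fun s => mink (deriv c s) (deriv c s) with hQ
  have hQs : ContDiffOn ℝ ∞ Q I := contDiff_mink.comp_contDiffOn (hc'.prodMk hc')
  have hQ0 : 0 < Q s₀ := lt_of_le_of_ne (mink_self_nonneg (hm _ hs₀) (htan _ hs₀))
    fun h => h0 (eq_zero_of_mink_self (hm _ hs₀) (htan _ hs₀) h.symm)
  have hopen : IsOpen (I ∩ Q ⁻¹' Ioi 0) := hQs.continuousOn.isOpen_inter_preimage hI isOpen_Ioi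
  obtain ⟨r, hr, hball⟩ := Metric.isOpen_iff.1 hopen s₀ ⟨hs₀, hQ0⟩
  set B := Metric.ball s₀ r with hB
  have hBo : IsOpen B := Metric.isOpen_ball
  have hs₀B : s₀ ∈ B := Metric.mem_ball_self hr
  set σ : ℝ → ℝ := fun s => Real.sqrt (Q s) with hσ
  have hσs : ContDiffOn ℝ ∞ σ B :=
    (hQs.mono fun s hs => (hball hs).1).sqrt fun s hs => (hball hs).2.ne'
  have hσpos : ∀ s ∈ B, 0 < σ s := fun s hs => Real.sqrt_pos.2 (hball hs).2
  -- The arc length from `s₀`; its local inverse is the reparametrization.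
  set ℓ : ℝ → ℝ := fun s => ∫ t in s₀..s, σ t with hℓ
  have hℓd : ∀ s ∈ B, HasDerivAt ℓ (σ s) s := by
    intro s hs
    refine intervalIntegral.integral_hasDerivAt_right ?_ ?_ ?_
    · refine (hσs.continuousOn.mono ?_).intervalIntegrable
      exact (convex_ball s₀ r).ordConnected.uIcc_subset hs₀B hs
    · exact hσs.continuousOn.stronglyMeasurableAtFilter hBo s hs
    · exact hσs.continuousOn.continuousAt (hBo.mem_nhds hs)
  have hℓs : ContDiffOn ℝ ∞ ℓ B := by
    rw [contDiffOn_infty_iff_deriv_of_isOpen hBo]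
    exact ⟨fun s hs => (hℓd s hs).differentiableAt.differentiableWithinAt,
      hσs.congr fun s hs => (hℓd s hs).deriv⟩
  have hinj : ∀ v : ℝ, (ContinuousLinearMap.toSpanSingleton ℝ (σ s₀)) v = 0 → v = 0 := by
    intro v hv
    simp only [ContinuousLinearMap.toSpanSingleton_apply, smul_eq_mul] at hv
    exact (mul_eq_zero.1 hv).resolve_right (hσpos _ hs₀B).ne'
  obtain ⟨e', he'⟩ := exists_continuousLinearEquiv rfl hinj
  have hℓf := (hℓd s₀ hs₀B).hasFDerivAt
  rw [← he'] at hℓf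
  obtain ⟨e, hse, heB, heℓ, hsm⟩ := exists_smooth_inverse hBo hℓs hs₀B hℓf
  -- The target of `e` need not be an interval, so a ball inside it serves as parameter domain.
  obtain ⟨ε, hε, hJ⟩ := Metric.isOpen_iff.1 e.open_target _ (e.map_source hse)
  set J := Metric.ball (e s₀) ε with hJdef
  refine ⟨e.source ∩ e ⁻¹' J, fun s hs => (hball (heB hs.1)).1,
    e.isOpen_inter_preimage Metric.isOpen_ball, ⟨hse, Metric.mem_ball_self hε⟩, J, c ∘ e.symm,
    ⟨Metric.isOpen_ball, (convex_ball _ _).ordConnected, ⟨_, Metric.mem_ball_self hε⟩, ?_, ?_, ?_⟩, ?_⟩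
  · exact hc.comp (hsm.mono hJ) fun t ht => (hball (heB (e.map_target (hJ ht)))).1
  · exact fun t ht => hm _ (hball (heB (e.map_target (hJ ht)))).1
  · intro t ht
    have hst := e.map_target (hJ ht)
    have hsB := heB hst
    have hed : HasDerivAt e (σ (e.symm t)) (e.symm t) :=
      (hℓd _ hsB).congr_of_eventuallyEq (Eventually.of_forall heℓ)
    have hid := e.hasDerivAt_symm (hJ ht) (hσpos _ hsB).ne' hed
    have hβ := (hcd _ (hball hsB).1).scomp t hid
    rw [hβ.deriv, mink_smul_left, mink_smul_right]
    have hsq : σ (e.symm t) * σ (e.symm t) = Q (e.symm t) := Real.mul_self_sqrt (hball hsB).2.le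
    change _ * (_ * Q (e.symm t)) = 1
    rw [← hsq]
    have := (hσpos _ hsB).ne'
    field_simp
  · ext y
    constructor
    · rintro ⟨t, ht, rfl⟩
      exact ⟨e.symm t, ⟨e.map_target (hJ ht), by rw [mem_preimage, e.right_inv (hJ ht)]; exact ht⟩, rfl⟩
    · rintro ⟨s, ⟨hs1, hs2⟩, rfl⟩
      exact ⟨e s, hs2, by simp [e.left_inv hs1]⟩

/-- Neither component of a Lagrangian tangent plane vanishes. -/
lemma LagPlane.exists_coord_ne_zero {x : W} {L : E2 →ₗ[ℝ] W} (h : LagPlane x L) :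
    (∃ v i, (L v).1 i ≠ 0) ∧ (∃ v i, (L v).2 i ≠ 0) := by
  obtain ⟨e₁, e₂, h₁, h₂, h₁₂, -⟩ := h.exists_orthonormal
  have hg := (h.gram h₁ h₂ h₁₂).1
  simp only [metricHH] at h₁ h₂
  constructor
  · by_contra! h'
    have h0 : ∀ v, (L v).1 = 0 := fun v => funext (h' v)
    simp [h0, mink_zero_left] at hg
  · by_contra! h'
    have h0 : ∀ v, (L v).2 = 0 := fun v => funext (h' v)
    simp only [h0, mink_zero_left] at h₁ h₂
    linarith

/-- A Lagrangian immersion whose components have degenerate differentials is locally a product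
of curves. -/
lemma exists_isProductOfCurves {O : Set E2} (hO : IsOpen O) {G : E2 → W}
    (hG : ContDiffOn ℝ ∞ G O) (hL : ∀ u ∈ O, LagPlane (G u) (fderiv ℝ G u))
    (h0 : ∀ u ∈ O, ∀ v w, omegaH (-1) (G u).1 (fderiv ℝ G u v).1 (fderiv ℝ G u w).1 = 0)
    {u₀ : E2} (hu₀ : u₀ ∈ O) :
    ∃ N ⊆ O, IsOpen N ∧ u₀ ∈ N ∧ IsProductOfCurves (G '' N) := by
  have hGd : ∀ u ∈ O, HasFDerivAt G (fderiv ℝ G u) u := fun u hu =>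
    ((hG.contDiffAt (hO.mem_nhds hu)).differentiableAt (by simp)).hasFDerivAt
  have h0' : ∀ u ∈ O, ∀ v w,
      omegaH (-1) (G u).2 (fderiv ℝ G u v).2 (fderiv ℝ G u w).2 = 0 := fun u hu v w => by
    have := (hL u hu).omega_eq v w
    rw [ContinuousLinearMap.coe_coe] at this
    rw [← this, h0 u hu]
  obtain ⟨⟨w₁, i, hi⟩, w₂, j, hj⟩ := (hL u₀ hu₀).exists_coord_ne_zero
  -- One coordinate of each component, chosen with nonzero differential. A vector killed by both has
  -- zero components by `eq_zero_of_omega_eq_zero`, so k ∘ G is a local chart.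
  set k : W →L[ℝ] ℝ × ℝ :=
    ((ContinuousLinearMap.proj (R := ℝ) (φ := fun _ : Fin 3 => ℝ) i).comp
      (ContinuousLinearMap.fst ℝ V V)).prod
    ((ContinuousLinearMap.proj (R := ℝ) (φ := fun _ : Fin 3 => ℝ) j).comp
      (ContinuousLinearMap.snd ℝ V V)) with hk
  have hk_apply : ∀ x : W, k x = (x.1 i, x.2 j) := fun x => rfl
  have hkd : HasFDerivAt (fun u => k (G u)) (k.comp (fderiv ℝ G u₀)) u₀ :=
    k.hasFDerivAt.comp u₀ (hGd u₀ hu₀)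
  have hinj : ∀ v, k.comp (fderiv ℝ G u₀) v = 0 → v = 0 := by
    intro v hv
    rw [ContinuousLinearMap.comp_apply, hk_apply, Prod.mk_eq_zero] at hv
    have e1 := eq_zero_of_omega_eq_zero (hL u₀ hu₀).mem.1 ((hL u₀ hu₀).tangent v).1
      ((hL u₀ hu₀).tangent w₁).1 (h0 u₀ hu₀ _ _) hv.1 hi
    have e2 := eq_zero_of_omega_eq_zero (hL u₀ hu₀).mem.2 ((hL u₀ hu₀).tangent v).2
      ((hL u₀ hu₀).tangent w₂).2 (h0' u₀ hu₀ _ _) hv.2 hj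
    exact (hL u₀ hu₀).inj ((Prod.ext e1 e2).trans (map_zero _).symm)
  obtain ⟨e', he'⟩ := exists_continuousLinearEquiv (by simp) hinj
  rw [← he'] at hkd
  obtain ⟨e, hue, heO, hek, hsm⟩ :=
    exists_smooth_inverse hO (k.contDiff.comp_contDiffOn hG) hu₀ hkd
  obtain ⟨r, hr, hball⟩ := Metric.isOpen_iff.1 e.open_target _ (e.map_source hue)
  obtain ⟨s₀, t₀, hst⟩ : ∃ s₀ t₀, e u₀ = (s₀, t₀) := ⟨_, _, rfl⟩
  rw [hst] at hball
  rw [← ball_prod_same] at hball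
  set I := Metric.ball s₀ r
  set K := Metric.ball t₀ r
  have hIo : IsOpen I := Metric.isOpen_ball
  have hKo : IsOpen K := Metric.isOpen_ball
  have hs₀ : s₀ ∈ I := Metric.mem_ball_self hr
  have ht₀ : t₀ ∈ K := Metric.mem_ball_self hr
  set γ : ℝ × ℝ → W := fun y => G (e.symm y) with hγ
  have hγs : ContDiffOn ℝ ∞ γ e.target := hG.comp hsm fun y hy => heO (e.map_target hy)
  have hγd : ∀ y ∈ e.target, HasFDerivAt γ (fderiv ℝ γ y) y := fun y hy =>
    ((hγs.contDiffAt (e.open_target.mem_nhds hy)).differentiableAt (by simp)).hasFDerivAt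
  have hγL : ∀ y ∈ e.target, ∀ η, ∃ v, fderiv ℝ γ y η = fderiv ℝ G (e.symm y) v := by
    intro y hy η
    have hs : HasFDerivAt e.symm (fderiv ℝ e.symm y) y :=
      ((hsm.contDiffAt (e.open_target.mem_nhds hy)).differentiableAt (by simp)).hasFDerivAt
    have := (hGd _ (heO (e.map_target hy))).comp y hs
    exact ⟨fderiv ℝ e.symm y η, by rw [(hγd y hy).unique this]; rfl⟩
  have hγk : ∀ y ∈ e.target, ∀ η, k (fderiv ℝ γ y η) = η := by
    intro y hy η
    have h1 := k.hasFDerivAt.comp y (hγd y hy)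
    have h2 : k ∘ γ =ᶠ[𝓝 y] id := by
      filter_upwards [e.open_target.mem_nhds hy] with z hz
      have := e.right_inv hz
      rwa [hek] at this
    have h3 := ((hasFDerivAt_id y).congr_of_eventuallyEq h2).unique h1
    exact (congrArg (fun L : ℝ × ℝ →L[ℝ] ℝ × ℝ => L η) h3).symm
  -- In the new chart coordinate `i` of the first component is the first variable: its derivative is
  -- 0 along (0, 1) and 1 along (1, 0). Both derivatives of this component are parallel, so the one
  -- along (0, 1) vanishes.
  have hker₁ : ∀ y ∈ e.target, (fderiv ℝ γ y (0, 1)).1 = 0 := by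
    intro y hy
    have hu := heO (e.map_target hy)
    have k1 := hγk y hy (0, 1)
    have k2 := hγk y hy (1, 0)
    obtain ⟨v, hv⟩ := hγL y hy (0, 1)
    obtain ⟨w, hw⟩ := hγL y hy (1, 0)
    rw [hv, hk_apply, Prod.mk.injEq] at k1
    rw [hw, hk_apply, Prod.mk.injEq] at k2
    rw [hv]
    exact eq_zero_of_omega_eq_zero (hL _ hu).mem.1 ((hL _ hu).tangent v).1
      ((hL _ hu).tangent w).1 (h0 _ hu _ _) k1.1 (k2.1.trans_ne one_ne_zero)
  have hker₂ : ∀ y ∈ e.target, (fderiv ℝ γ y (1, 0)).2 = 0 := by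
    intro y hy
    have hu := heO (e.map_target hy)
    have k1 := hγk y hy (0, 1)
    have k2 := hγk y hy (1, 0)
    obtain ⟨v, hv⟩ := hγL y hy (0, 1)
    obtain ⟨w, hw⟩ := hγL y hy (1, 0)
    rw [hv, hk_apply, Prod.mk.injEq] at k1
    rw [hw, hk_apply, Prod.mk.injEq] at k2
    rw [hw]
    exact eq_zero_of_omega_eq_zero (hL _ hu).mem.2 ((hL _ hu).tangent w).2
      ((hL _ hu).tangent v).2 (h0' _ hu _ _) k2.2 (k1.2.trans_ne one_ne_zero)
  have hdt : ∀ s ∈ I, ∀ t ∈ K, HasDerivAt (fun τ => γ (s, τ)) (fderiv ℝ γ (s, t) (0, 1)) t :=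
    fun s hs t ht => (hγd _ (hball ⟨hs, ht⟩)).comp_hasDerivAt t
      ((hasDerivAt_const t s).prodMk (hasDerivAt_id t))
  have hds : ∀ s ∈ I, ∀ t ∈ K, HasDerivAt (fun τ => γ (τ, t)) (fderiv ℝ γ (s, t) (1, 0)) s :=
    fun s hs t ht => (hγd _ (hball ⟨hs, ht⟩)).comp_hasDerivAt s
      ((hasDerivAt_id s).prodMk (hasDerivAt_const s t))
  have hdt₁ : ∀ s ∈ I, ∀ t ∈ K,
      HasDerivAt (fun τ => (γ (s, τ)).1) (fderiv ℝ γ (s, t) (0, 1)).1 t := fun s hs t ht =>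
    (ContinuousLinearMap.fst ℝ V V).hasFDerivAt.comp_hasDerivAt t (hdt s hs t ht)
  have hdt₂ : ∀ s ∈ I, ∀ t ∈ K,
      HasDerivAt (fun τ => (γ (s, τ)).2) (fderiv ℝ γ (s, t) (0, 1)).2 t := fun s hs t ht =>
    (ContinuousLinearMap.snd ℝ V V).hasFDerivAt.comp_hasDerivAt t (hdt s hs t ht)
  have hds₁ : ∀ s ∈ I, ∀ t ∈ K,
      HasDerivAt (fun τ => (γ (τ, t)).1) (fderiv ℝ γ (s, t) (1, 0)).1 s := fun s hs t ht =>
    (ContinuousLinearMap.fst ℝ V V).hasFDerivAt.comp_hasDerivAt s (hds s hs t ht)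
  have hds₂ : ∀ s ∈ I, ∀ t ∈ K,
      HasDerivAt (fun τ => (γ (τ, t)).2) (fderiv ℝ γ (s, t) (1, 0)).2 s := fun s hs t ht =>
    (ContinuousLinearMap.snd ℝ V V).hasFDerivAt.comp_hasDerivAt s (hds s hs t ht)
  have hconst₁ : ∀ s ∈ I, ∀ t ∈ K, (γ (s, t)).1 = (γ (s, t₀)).1 := fun s hs t ht =>
    hKo.is_const_of_deriv_eq_zero (f := fun τ => (γ (s, τ)).1) (convex_ball t₀ r).isPreconnected
      (fun τ hτ => (hdt₁ s hs τ hτ).differentiableAt.differentiableWithinAt)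
      (fun τ hτ => (hdt₁ s hs τ hτ).deriv.trans (hker₁ _ (hball ⟨hs, hτ⟩))) ht ht₀
  have hconst₂ : ∀ s ∈ I, ∀ t ∈ K, (γ (s, t)).2 = (γ (s₀, t)).2 := fun s hs t ht =>
    hIo.is_const_of_deriv_eq_zero (f := fun τ => (γ (τ, t)).2) (convex_ball s₀ r).isPreconnected
      (fun τ hτ => (hds₂ τ hτ t ht).differentiableAt.differentiableWithinAt)
      (fun τ hτ => (hds₂ τ hτ t ht).deriv.trans (hker₂ _ (hball ⟨hτ, ht⟩))) hs hs₀
  have hmem : ∀ y ∈ e.target, γ y ∈ HH := fun y hy => (hL _ (heO (e.map_target hy))).mem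
  have hc₁ : ContDiffOn ℝ ∞ (fun s => (γ (s, t₀)).1) I := by
    have : ContDiffOn ℝ ∞ (fun s : ℝ => (s, t₀)) I := by fun_prop
    exact contDiff_fst.comp_contDiffOn (hγs.comp this fun s hs => hball ⟨hs, ht₀⟩)
  have hc₂ : ContDiffOn ℝ ∞ (fun t => (γ (s₀, t)).2) K := by
    have : ContDiffOn ℝ ∞ (fun t : ℝ => (s₀, t)) K := by fun_prop
    exact contDiff_snd.comp_contDiffOn (hγs.comp this fun t ht => hball ⟨hs₀, ht⟩)
  have hreg₁ : deriv (fun s => (γ (s, t₀)).1) s₀ ≠ 0 := by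
    rw [(hds₁ s₀ hs₀ t₀ ht₀).deriv]
    intro h
    have := hγk _ (hball (mk_mem_prod hs₀ ht₀)) (1, 0)
    simp [hk_apply, h] at this
  have hreg₂ : deriv (fun t => (γ (s₀, t)).2) t₀ ≠ 0 := by
    rw [(hdt₂ s₀ hs₀ t₀ ht₀).deriv]
    intro h
    have := hγk _ (hball (mk_mem_prod hs₀ ht₀)) (0, 1)
    simp [hk_apply, h] at this
  obtain ⟨I₁, hI₁, hI₁o, hs₁, J₁, β₁, hβ₁, himg₁⟩ := exists_unitSpeed_reparam hIo hc₁
    (fun s hs => (hmem _ (hball ⟨hs, ht₀⟩)).1) hs₀ hreg₁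
  obtain ⟨I₂, hI₂, hI₂o, hs₂, J₂, β₂, hβ₂, himg₂⟩ := exists_unitSpeed_reparam hKo hc₂
    (fun t ht => (hmem _ (hball ⟨hs₀, ht⟩)).2) ht₀ hreg₂
  refine ⟨e.source ∩ e ⁻¹' (I₁ ×ˢ I₂), fun u hu => heO hu.1,
    e.isOpen_inter_preimage (hI₁o.prod hI₂o), ⟨hue, ?_⟩, J₁, J₂, β₁, β₂, hβ₁, hβ₂, ?_⟩
  · rw [mem_preimage, hst]; exact ⟨hs₁, hs₂⟩
  · ext x
    constructor
    · rintro ⟨u, ⟨hu, hu1, hu2⟩, rfl⟩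
      have e1 : G u = γ (e u) := by simp [hγ, e.left_inv hu]
      obtain ⟨a, ha, hab⟩ : (γ ((e u).1, t₀)).1 ∈ β₁ '' J₁ := by
        rw [himg₁]; exact ⟨_, hu1, rfl⟩
      obtain ⟨b, hb, hbb⟩ : (γ (s₀, (e u).2)).2 ∈ β₂ '' J₂ := by
        rw [himg₂]; exact ⟨_, hu2, rfl⟩
      refine ⟨(a, b), ⟨ha, hb⟩, ?_⟩
      rw [e1]
      refine Prod.ext ?_ ?_
      · exact hab.trans (hconst₁ _ (hI₁ hu1) _ (hI₂ hu2)).symm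
      · exact hbb.trans (hconst₂ _ (hI₁ hu1) _ (hI₂ hu2)).symm
    · rintro ⟨⟨a, b⟩, ⟨ha, hb⟩, rfl⟩
      obtain ⟨s, hs, hsa⟩ : β₁ a ∈ (fun s => (γ (s, t₀)).1) '' I₁ := by
        rw [← himg₁]; exact ⟨a, ha, rfl⟩
      obtain ⟨t, ht, htb⟩ : β₂ b ∈ (fun t => (γ (s₀, t)).2) '' I₂ := by
        rw [← himg₂]; exact ⟨b, hb, rfl⟩
      have hst := hball (mk_mem_prod (hI₁ hs) (hI₂ ht))
      refine ⟨e.symm (s, t), ⟨e.map_target hst, ?_⟩, ?_⟩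
      · rw [mem_preimage, e.right_inv hst]; exact ⟨hs, ht⟩
      · refine Prod.ext ?_ ?_
        · exact (hconst₁ _ (hI₁ hs) _ (hI₂ ht)).trans hsa
        · exact (hconst₂ _ (hI₁ hs) _ (hI₂ ht)).trans htb

/-! ### Lorentz transformations -/

lemma det_of_rows (x y z : V) : (Matrix.of ![x, y, z]).det = mink (cross x y) z := by
  rw [Matrix.det_fin_three, mink_cross]; simp; ring

lemma mink_cross_mulVec (A : Matrix (Fin 3) (Fin 3) ℝ) (x y z : V) :
    mink (cross (A.mulVec x) (A.mulVec y)) (A.mulVec z) = A.det * mink (cross x y) z := by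
  rw [← det_of_rows, ← det_of_rows, ← Matrix.det_transpose A, mul_comm, ← Matrix.det_mul]
  congr 1
  ext i j
  fin_cases i <;> simp [Matrix.mul_apply, Matrix.mulVec, dotProduct, mul_comm]

/-- Pairing with an arbitrary vector A(A⁻¹b) turns the claim into the transformation rule of the
determinant. This is what makes proper Lorentz maps commute with the complex structure. -/
lemma cross_mulVec {A : Matrix (Fin 3) (Fin 3) ℝ}
    (hA : ∀ a b : V, mink (A.mulVec a) (A.mulVec b) = mink a b) (hd : A.det = 1) (x y : V) :
    cross (A.mulVec x) (A.mulVec y) = A.mulVec (cross x y) := by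
  rw [← sub_eq_zero]
  refine eq_zero_of_mink_eq_zero fun b => ?_
  have hb : A.mulVec (A⁻¹.mulVec b) = b := by
    rw [Matrix.mulVec_mulVec, Matrix.mul_nonsing_inv _ (by simp [hd]), Matrix.one_mulVec]
  rw [← hb, mink_sub_left, mink_cross_mulVec, hA, hd, one_mul, sub_self]

/-- A Lorentz transformation that maps some point of the hyperbolic plane into the hyperbolic
plane is orthochronous. -/
lemma isOrthochronous_of_mem {A : Matrix (Fin 3) (Fin 3) ℝ}
    (hA : ∀ a b : V, mink (A.mulVec a) (A.mulVec b) = mink a b) {x : V} (hx : x ∈ H2 (-1))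
    (hAx : A.mulVec x ∈ H2 (-1)) : IsOrthochronous A := by
  refine ⟨hA, ?_⟩
  set e : V := ![1, 0, 0] with he
  have h00 : (A.mulVec e) 0 = A 0 0 := by
    simp [he, Matrix.mulVec, dotProduct, Fin.sum_univ_three]
  rw [← h00]
  set f := A.mulVec e
  set y := A.mulVec x
  have h1 : mink f f = -1 := by rw [hA]; simp [mink, he]
  have h2 : mink y f = - x 0 := by rw [hA]; simp [mink, he]
  obtain ⟨hy1, hy2⟩ := mem_H2_neg_one hAx
  have hx2 := (mem_H2_neg_one hx).2
  -- If f₀ ≤ 0, then y₁f₁ + y₂f₂ = y₀f₀ - x₀ < y₀f₀ ≤ 0. Squaring contradicts Cauchy–Schwarz, as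
  -- (y₀f₀)² = (1 + y₁² + y₂²)(1 + f₁² + f₂²).
  by_contra! hf
  simp only [mink] at h1 h2 hy1
  have h3 : y 1 * f 1 + y 2 * f 2 < y 0 * f 0 := by linarith
  have h4 : y 0 * f 0 ≤ 0 := mul_nonpos_of_nonneg_of_nonpos hy2.le hf
  have h5 : (y 0 * f 0) ^ 2 < (y 1 * f 1 + y 2 * f 2) ^ 2 := by nlinarith
  have h6 : (y 0 * f 0) ^ 2 = (1 + y 1 ^ 2 + y 2 ^ 2) * (1 + f 1 ^ 2 + f 2 ^ 2) := by
    rw [mul_pow, show y 0 ^ 2 = 1 + y 1 ^ 2 + y 2 ^ 2 by linarith,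
      show f 0 ^ 2 = 1 + f 1 ^ 2 + f 2 ^ 2 by linarith]
  nlinarith [sq_nonneg (y 1 * f 2 - y 2 * f 1), sq_nonneg (y 1), sq_nonneg (y 2),
    sq_nonneg (f 1), sq_nonneg (f 2)]

lemma isOrthochronous_one : IsOrthochronous 1 := ⟨fun a b => by simp, by simp⟩

/-- A point of the hyperbolic plane is determined by its last two coordinates. -/
lemma planeProj_injOn : InjOn planeProj (H2 (-1)) := by
  intro x hx y hy h
  rw [planeProj_apply, planeProj_apply, Prod.mk.injEq] at h
  obtain ⟨hx1, hx2⟩ := mem_H2_neg_one hx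
  obtain ⟨hy1, hy2⟩ := mem_H2_neg_one hy
  simp only [mink, h.1, h.2] at hx1 hy1
  have h0 : x 0 = y 0 := by
    have : x 0 ^ 2 = y 0 ^ 2 := by linarith
    exact (pow_left_inj₀ hx2.le hy2.le two_ne_zero).1 this
  ext i; fin_cases i
  exacts [h0, h.1, h.2]

lemma smul_mem_H2_iff (x : V) : (1 / Real.sqrt 2) • x ∈ H2 (-1) ↔ x ∈ H2 (-1 / 2) := by
  have h2 : (0 : ℝ) < Real.sqrt 2 := by positivity
  simp only [H2, mem_ofPred_eq, mink_smul_left, mink_smul_right, Pi.smul_apply, smul_eq_mul]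
  have : 1 / Real.sqrt 2 * (1 / Real.sqrt 2 * mink x x) = mink x x / 2 := by
    rw [← mul_assoc, div_mul_div_comm, Real.mul_self_sqrt (by norm_num)]; ring
  rw [this]
  have e : (1 / Real.sqrt 2) * x 0 = x 0 / Real.sqrt 2 := by ring
  rw [e, div_pos_iff_of_pos_right h2]
  constructor
  · rintro ⟨a, b⟩; exact ⟨by linarith, b⟩
  · rintro ⟨a, b⟩; exact ⟨by linarith, b⟩

/-! ### Transfer to surfaces through charts -/

section Surface

variable {S : Type*} [TopologicalSpace S] [ChartedSpace (EuclideanSpace ℝ (Fin 2)) S]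

/-- The differential, as a map on the model space. -/
def diffE2 {F : Type*} [NormedAddCommGroup F] [NormedSpace ℝ F] (f : S → F) (p : S) :
    E2 →L[ℝ] F :=
  diff f p

lemma hasMFDerivAt_clm_comp {F F' : Type*} [NormedAddCommGroup F] [NormedSpace ℝ F]
    [NormedAddCommGroup F'] [NormedSpace ℝ F'] {f : S → F}
    (hf : ContMDiff 𝓘(ℝ, E2) 𝓘(ℝ, F) ∞ f) (R : F →L[ℝ] F') (p : S) :
    HasMFDerivAt 𝓘(ℝ, E2) 𝓘(ℝ, F') (fun q => R (f q)) p (R.comp (diffE2 f p)) :=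
  HasMFDerivAt.comp p (R.hasFDerivAt.hasMFDerivAt) ((hf p).mdifferentiableAt (by simp)).hasMFDerivAt

/-- Linear relations between the components of a map, such as φ₂ = Lφ₁, pass to its differential by
this lemma. -/
lemma clm_diff_eq_zero {F F' : Type*} [NormedAddCommGroup F] [NormedSpace ℝ F]
    [NormedAddCommGroup F'] [NormedSpace ℝ F'] {f : S → F}
    (hf : ContMDiff 𝓘(ℝ, E2) 𝓘(ℝ, F) ∞ f) (R : F →L[ℝ] F') {p : S}
    (h : ∀ᶠ q in 𝓝 p, R (f q) = 0) (v : E2) : R (diffE2 f p v) = 0 := by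
  have h1 : HasMFDerivAt 𝓘(ℝ, E2) 𝓘(ℝ, F') (fun q => R (f q)) p
      (0 : TangentSpace 𝓘(ℝ, E2) p →L[ℝ] TangentSpace 𝓘(ℝ, F') (R (f p))) := by
    have h2 := hasMFDerivAt_const (I := 𝓘(ℝ, E2)) (I' := 𝓘(ℝ, F')) (0 : F') p
    exact h2.congr_of_eventuallyEq h
  have h3 := hasMFDerivAt_unique h1 (hasMFDerivAt_clm_comp hf R p)
  exact (congrArg (fun L : E2 →L[ℝ] F' => L v) h3).symm

variable {Φ : S → W}

namespace IsLagrangianImmersion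

lemma diff_fst (h : IsLagrangianImmersion Φ) (p : S) (v : E2) :
    diffE2 (fun q => (Φ q).1) p v = (diffE2 Φ p v).1 := by
  have := (hasMFDerivAt_clm_comp h.smooth (ContinuousLinearMap.fst ℝ V V) p).mfderiv
  exact congrArg (fun L : E2 →L[ℝ] V => L v) this

lemma diff_snd (h : IsLagrangianImmersion Φ) (p : S) (v : E2) :
    diffE2 (fun q => (Φ q).2) p v = (diffE2 Φ p v).2 := by
  have := (hasMFDerivAt_clm_comp h.smooth (ContinuousLinearMap.snd ℝ V V) p).mfderiv
  exact congrArg (fun L : E2 →L[ℝ] V => L v) this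

/-- The components of an immersion congruent to the diagonal induce the same metric. -/
lemma mink_eq_of_isOpenPartOfDiagonal (h : IsLagrangianImmersion Φ) {T : W →ₗ[ℝ] W}
    (hT : IsIsometryHH T) (hd : IsOpenPartOfDiagonal (T '' range Φ)) (p : S) (u v : E2) :
    mink (diffE2 Φ p u).1 (diffE2 Φ p v).1 = mink (diffE2 Φ p u).2 (diffE2 Φ p v).2 := by
  obtain ⟨O, -, hO⟩ := hd
  have hΦ : ∀ q, (T (Φ q)).1 = (T (Φ q)).2 := by
    intro q
    obtain ⟨x, -, hx⟩ : T (Φ q) ∈ diagonal '' (O ∩ H2 (-1 / 2)) := hO ▸ ⟨_, ⟨q, rfl⟩, rfl⟩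
    rw [← hx]; rfl
  set T' : W →L[ℝ] W := LinearMap.toContinuousLinearMap T
  have hdT : ∀ v : E2, (T (diffE2 Φ p v)).1 = (T (diffE2 Φ p v)).2 := fun v => by
    have := clm_diff_eq_zero h.smooth ((ContinuousLinearMap.fst ℝ V V -
      ContinuousLinearMap.snd ℝ V V).comp T') (p := p)
      (Eventually.of_forall fun q => sub_eq_zero.2 (hΦ q)) v
    exact sub_eq_zero.1 this
  obtain ⟨A, B, hA, hB, hT | hT⟩ := hT
  · simp only [hT] at hdT
    rw [← hA.1, hdT, hdT, hB.1]
  · simp only [hT] at hdT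
    rw [← hB.1, ← hdT, ← hdT, hA.1]

end IsLagrangianImmersion

variable [IsManifold 𝓘(ℝ, EuclideanSpace ℝ (Fin 2)) ∞ S]

/-- In a chart, the differential is the Fréchet derivative up to an isomorphism of the tangent
plane. -/
lemma exists_equiv_chart {F : Type*} [NormedAddCommGroup F] [NormedSpace ℝ F] {f : S → F}
    (hf : ContMDiff 𝓘(ℝ, E2) 𝓘(ℝ, F) ∞ f) (p : S) {u : E2} (hu : u ∈ (chartAt E2 p).target) :
    ∃ M : E2 ≃L[ℝ] E2, ∀ v : E2,
      fderiv ℝ (f ∘ (chartAt E2 p).symm) u v = diffE2 f ((chartAt E2 p).symm u) (M v) := by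
  have hM := (mdifferentiable_chart (I := 𝓘(ℝ, E2)) p).symm
  let M : E2 ≃L[ℝ] E2 := hM.mfderiv hu
  refine ⟨M, fun v => ?_⟩
  have h1 := ((hf ((chartAt E2 p).symm u)).mdifferentiableAt (by simp)).hasMFDerivAt
  have h2 := (hM.mdifferentiableAt hu).hasMFDerivAt
  have h3 : HasFDerivAt (f ∘ (chartAt E2 p).symm)
      ((diffE2 f ((chartAt E2 p).symm u)).comp (M : E2 →L[ℝ] E2)) u := (h1.comp u h2).hasFDerivAt
  rw [h3.fderiv]
  rfl

lemma contDiffOn_chart {F : Type*} [NormedAddCommGroup F] [NormedSpace ℝ F] {f : S → F}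
    (hf : ContMDiff 𝓘(ℝ, E2) 𝓘(ℝ, F) ∞ f) (p : S) :
    ContDiffOn ℝ ∞ (f ∘ (chartAt E2 p).symm) (chartAt E2 p).target := by
  rw [← contMDiffOn_iff_contDiffOn]
  exact hf.comp_contMDiffOn (contMDiffOn_chart_symm (n := ∞))

namespace IsLagrangianImmersion

lemma tangent (h : IsLagrangianImmersion Φ) (p : S) (v : E2) :
    diffE2 Φ p v ∈ tangentHH (Φ p) := by
  -- Stated at points of the form `(chartAt E2 p).symm u`, where the chart formula for the
  -- differential applies; the centre of the chart then gives `p`.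
  have key : ∀ u ∈ (chartAt E2 p).target, ∀ v : E2,
      diffE2 Φ ((chartAt E2 p).symm u) v ∈ tangentHH (Φ ((chartAt E2 p).symm u)) := by
    intro u hu v
    obtain ⟨M, hM⟩ := exists_equiv_chart h.smooth p hu
    have hd := ((contDiffOn_chart h.smooth p).contDiffAt
      ((chartAt E2 p).open_target.mem_nhds hu)).differentiableAt (by simp) |>.hasFDerivAt
    have h1 := mink_fderiv_eq_zero ((ContinuousLinearMap.fst ℝ V V).hasFDerivAt.comp u hd)
      (Eventually.of_forall fun z => (h.mem _).1) (M.symm v)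
    have h2 := mink_fderiv_eq_zero ((ContinuousLinearMap.snd ℝ V V).hasFDerivAt.comp u hd)
      (Eventually.of_forall fun z => (h.mem _).2) (M.symm v)
    simp only [ContinuousLinearMap.comp_apply, hM, M.apply_symm_apply] at h1 h2
    exact ⟨h1, h2⟩
  have := key (chartAt E2 p p) (mem_chart_target E2 p)
  rw [(chartAt E2 p).left_inv (mem_chart_source E2 p)] at this
  exact this v

lemma lagPlane (h : IsLagrangianImmersion Φ) (p : S) :
    LagPlane (Φ p) (diffE2 Φ p : E2 →ₗ[ℝ] W) where
  mem := h.mem p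
  tangent := h.tangent p
  inj := h.immersion p
  omega_eq u v := by
    have := h.lagrangian p u v
    rw [omegaHH_eq, sub_eq_zero] at this
    exact this

lemma lagPlane_chart (h : IsLagrangianImmersion Φ) (p : S) {u : E2}
    (hu : u ∈ (chartAt E2 p).target) :
    LagPlane ((Φ ∘ (chartAt E2 p).symm) u)
      (fderiv ℝ (Φ ∘ (chartAt E2 p).symm) u : E2 →ₗ[ℝ] W) := by
  obtain ⟨M, hM⟩ := exists_equiv_chart h.smooth p hu
  have he : (fderiv ℝ (Φ ∘ (chartAt E2 p).symm) u : E2 →ₗ[ℝ] W) =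
      (diffE2 Φ ((chartAt E2 p).symm u) : E2 →ₗ[ℝ] W) ∘ₗ (M.toLinearEquiv : E2 →ₗ[ℝ] E2) :=
    LinearMap.ext hM
  rw [he]
  exact (h.lagPlane _).comp M.injective

/-- Immersions with degenerate components are locally products of curves. -/
lemma exists_nhds_isProductOfCurves (h : IsLagrangianImmersion Φ)
    (h0 : ∀ p, ∀ u v : E2, omegaH (-1) (Φ p).1 (diffE2 Φ p u).1 (diffE2 Φ p v).1 = 0) (p : S) :
    ∃ U : Set S, IsOpen U ∧ p ∈ U ∧ IsProductOfCurves (Φ '' U) := by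
  have hp : p ∈ (chartAt E2 p).source := mem_chart_source E2 p
  obtain ⟨N, hN, hNo, hpN, hprod⟩ := exists_isProductOfCurves (chartAt E2 p).open_target
    (contDiffOn_chart h.smooth p) (fun u hu => h.lagPlane_chart p hu) (fun u hu v w => by
      obtain ⟨M, hM⟩ := exists_equiv_chart h.smooth p hu
      rw [hM, hM]
      exact h0 _ _ _) ((chartAt E2 p).map_source hp)
  refine ⟨(chartAt E2 p).source ∩ chartAt E2 p ⁻¹' N,
    (chartAt E2 p).isOpen_inter_preimage hNo, ⟨hp, hpN⟩, ?_⟩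
  rwa [← (chartAt E2 p).symm_image_eq_source_inter_preimage hN, ← image_comp]

/-- Immersions into a product of curves have degenerate components. -/
lemma omega_eq_zero_of_subset (h : IsLagrangianImmersion Φ) {M : Set W}
    (hM : IsProductOfCurves M) {U : Set S} (hU : IsOpen U) (hUM : Φ '' U ⊆ M) {p : S} (hp : p ∈ U)
    (v w : E2) : omegaH (-1) (Φ p).1 (diffE2 Φ p v).1 (diffE2 Φ p w).1 = 0 := by
  obtain ⟨I₁, I₂, β₁, β₂, hβ₁, hβ₂, rfl⟩ := hM
  have key : ∀ u ∈ (chartAt E2 p).target, (chartAt E2 p).symm u ∈ U →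
      ∀ v w : E2,
      omegaH (-1) (Φ ((chartAt E2 p).symm u)).1 (diffE2 Φ ((chartAt E2 p).symm u) v).1
        (diffE2 Φ ((chartAt E2 p).symm u) w).1 = 0 := by
    intro u hu huU v w
    obtain ⟨A, hA⟩ := exists_equiv_chart h.smooth p hu
    have hnh := (chartAt E2 p).open_target.mem_nhds hu
    have hd := ((contDiffOn_chart h.smooth p).contDiffAt hnh).hasStrictFDerivAt (by simp)
    have h1 := omega_eq_zero_of_image_subset_curve
      ((ContinuousLinearMap.fst ℝ V V).hasStrictFDerivAt.comp u hd)
      (Eventually.of_forall fun z => (h.mem _).1) hβ₁ (by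
        filter_upwards [((chartAt E2 p).continuousAt_symm hu).preimage_mem_nhds
          (hU.mem_nhds huU)] with z hz
        obtain ⟨s, hs, hsz⟩ := hUM ⟨_, hz, rfl⟩
        exact ⟨s.1, hs.1, congrArg Prod.fst hsz⟩) (A.symm v) (A.symm w)
    simp only [ContinuousLinearMap.comp_apply, hA, A.apply_symm_apply] at h1
    exact h1
  have := key (chartAt E2 p p) (mem_chart_target E2 p)
  rw [(chartAt E2 p).left_inv (mem_chart_source E2 p)] at this
  exact this hp v w

/-- If the first component of a tangent vector vanishes, equality of the metrics makes the second
one null, hence zero by definiteness. -/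
lemma diff_fst_injective (h : IsLagrangianImmersion Φ)
    (hiso : ∀ p, ∀ u v : E2, mink (diffE2 Φ p u).1 (diffE2 Φ p v).1 =
      mink (diffE2 Φ p u).2 (diffE2 Φ p v).2) (p : S) (v : E2) (hv : (diffE2 Φ p v).1 = 0) :
    v = 0 := by
  have h1 := hiso p v v
  rw [hv, mink_zero_left] at h1
  have h2 := eq_zero_of_mink_self (h.mem p).2 (h.tangent p v).2 h1.symm
  exact h.immersion p ((Prod.ext hv h2).trans (map_zero _).symm)

lemma exists_local_linear_isometry (h : IsLagrangianImmersion Φ)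
    (hiso : ∀ p, ∀ u v : E2, mink (diffE2 Φ p u).1 (diffE2 Φ p v).1 =
      mink (diffE2 Φ p u).2 (diffE2 Φ p v).2) (p : S) :
    ∃ L : V →L[ℝ] V, (∀ v w, mink (L v) (L w) = mink v w) ∧
      ∀ᶠ q in 𝓝 p, (Φ q).2 = L (Φ q).1 := by
  set c := chartAt E2 p with hc
  have hp : p ∈ c.source := mem_chart_source E2 p
  have hG := contDiffOn_chart h.smooth p
  set G := Φ ∘ c.symm with hGdef
  have hGd : ∀ u ∈ c.target, HasFDerivAt G (fderiv ℝ G u) u := fun u hu =>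
    ((hG.contDiffAt (c.open_target.mem_nhds hu)).differentiableAt (by simp)).hasFDerivAt
  have hG₁ : ∀ u ∈ c.target, ∀ v, fderiv ℝ (fun u => (G u).1) u v = (fderiv ℝ G u v).1 :=
    fun u hu v => by
      have := (ContinuousLinearMap.fst ℝ V V).hasFDerivAt.comp u (hGd u hu)
      exact congrArg (fun L : E2 →L[ℝ] V => L v) this.fderiv
  have hG₂ : ∀ u ∈ c.target, ∀ v, fderiv ℝ (fun u => (G u).2) u v = (fderiv ℝ G u v).2 :=
    fun u hu v => by
      have := (ContinuousLinearMap.snd ℝ V V).hasFDerivAt.comp u (hGd u hu)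
      exact congrArg (fun L : E2 →L[ℝ] V => L v) this.fderiv
  obtain ⟨L, hL, hev⟩ := LagHH.exists_local_linear_isometry c.open_target
    (contDiff_fst.comp_contDiffOn hG) (contDiff_snd.comp_contDiffOn hG)
    (fun u _ => (h.mem _).1) (fun u _ => (h.mem _).2)
    (fun u hu v hv => by
      obtain ⟨M, hM⟩ := exists_equiv_chart h.smooth p hu
      have h1 := (hG₁ u hu v).symm.trans hv
      rw [hGdef, hc, hM] at h1
      exact M.map_eq_zero_iff.1 (h.diff_fst_injective hiso _ _ h1))
    (fun u hu v w => by
      obtain ⟨M, hM⟩ := exists_equiv_chart h.smooth p hu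
      refine (congrArg₂ mink (hG₁ u hu v) (hG₁ u hu w)).trans (Eq.trans ?_
        (congrArg₂ mink (hG₂ u hu v) (hG₂ u hu w)).symm)
      rw [hGdef, hc, hM, hM]
      exact hiso _ _ _) (c.map_source hp)
  refine ⟨L, hL, ?_⟩
  filter_upwards [(c.continuousAt hp).eventually hev, c.open_source.mem_nhds hp] with q hq hqs
  simpa [hGdef, c.left_inv hqs] using hq

/-- A linear map is determined by its values on the first component near a point. -/
lemma clm_eq_of_eventually (h : IsLagrangianImmersion Φ)
    (hiso : ∀ p, ∀ u v : E2, mink (diffE2 Φ p u).1 (diffE2 Φ p v).1 =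
      mink (diffE2 Φ p u).2 (diffE2 Φ p v).2) {p : S} {L L' : V →L[ℝ] V}
    (hL : ∀ᶠ q in 𝓝 p, L (Φ q).1 = L' (Φ q).1) : L = L' := by
  set R : V →L[ℝ] V := L - L' with hR
  have hR0 : ∀ᶠ q in 𝓝 p, (R.comp (ContinuousLinearMap.fst ℝ V V)) (Φ q) = 0 := by
    filter_upwards [hL] with q hq
    simp [hR, hq]
  have hRd : ∀ v : E2, R (diffE2 Φ p v).1 = 0 := fun v => clm_diff_eq_zero h.smooth _ hR0 v
  -- The tangent plane of the first component and its position vector, which is timelike and normal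
  -- to it, together span Minkowski space.
  set D : E2 × ℝ →L[ℝ] V :=
    ((ContinuousLinearMap.fst ℝ V V).comp (diffE2 Φ p)).coprod
      (ContinuousLinearMap.toSpanSingleton ℝ (Φ p).1) with hD
  have hDa : ∀ v, D v = (diffE2 Φ p v.1).1 + v.2 • (Φ p).1 := fun v => rfl
  have hDinj : ∀ v, D v = 0 → v = 0 := by
    intro v hv
    rw [hDa] at hv
    have h1 := congrArg (mink (Φ p).1) hv
    rw [mink_add_right, mink_smul_right, (h.tangent p v.1).1, mink_zero_right,
      (mem_H2_neg_one (h.mem p).1).1] at h1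
    have h2 : v.2 = 0 := by linarith
    rw [h2, zero_smul, add_zero] at hv
    exact Prod.ext (h.diff_fst_injective hiso p v.1 hv) h2
  obtain ⟨e, he⟩ := exists_continuousLinearEquiv (by simp) hDinj
  have hzero : R = 0 := by
    ext1 y
    obtain ⟨v, rfl⟩ := e.surjective y
    have : e v = D v := congrArg (fun L : E2 × ℝ →L[ℝ] V => L v) he
    have h0 : R (Φ p).1 = 0 := hR0.self_of_nhds
    rw [this, hDa, map_add, map_smul, h0, hRd]; simp
  exact sub_eq_zero.1 hzero

/-- The components of an immersion inducing the same metric differ by a linear isometry. -/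
lemma exists_linear_isometry [ConnectedSpace S] (h : IsLagrangianImmersion Φ)
    (hiso : ∀ p, ∀ u v : E2, mink (diffE2 Φ p u).1 (diffE2 Φ p v).1 =
      mink (diffE2 Φ p u).2 (diffE2 Φ p v).2) :
    ∃ L : V →L[ℝ] V, (∀ v w, mink (L v) (L w) = mink v w) ∧ ∀ q, (Φ q).2 = L (Φ q).1 := by
  choose L hL hev using h.exists_local_linear_isometry hiso
  have hloc : IsLocallyConstant L := by
    rw [IsLocallyConstant.iff_eventually_eq]
    intro p
    filter_upwards [(hev p).eventually_nhds] with q hq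
    refine h.clm_eq_of_eventually hiso (p := q) ?_
    filter_upwards [hq, hev q] with z h1 h2
    rw [← h1, ← h2]
  obtain ⟨p₀⟩ := (inferInstance : Nonempty S)
  refine ⟨L p₀, hL p₀, fun q => ?_⟩
  rw [hloc.apply_eq_of_preconnectedSpace p₀ q]
  exact (hev q).self_of_nhds

/-- This supplies the open set in `IsOpenPartOfDiagonal`: the last two coordinates are global
coordinates on the hyperbolic plane. -/
lemma isOpen_range_planeProj_snd (h : IsLagrangianImmersion Φ)
    (h0 : ∀ p, ∃ u v : E2, omegaH (-1) (Φ p).1 (diffE2 Φ p u).1 (diffE2 Φ p v).1 ≠ 0) :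
    IsOpen (range fun p => planeProj (Φ p).2) := by
  rw [isOpen_iff_mem_nhds]
  rintro _ ⟨p, rfl⟩
  have key : ∀ u ∈ (chartAt E2 p).target,
      (range fun p => planeProj (Φ p).2) ∈ 𝓝 (planeProj (Φ ((chartAt E2 p).symm u)).2) := by
    intro u hu
    obtain ⟨A, hA⟩ := exists_equiv_chart h.smooth p hu
    have hd := ((contDiffOn_chart h.smooth p).contDiffAt
      ((chartAt E2 p).open_target.mem_nhds hu)).hasStrictFDerivAt (by simp)
    obtain ⟨v, w, hvw⟩ := h0 ((chartAt E2 p).symm u)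
    have he := (h.lagPlane ((chartAt E2 p).symm u)).omega_eq v w
    rw [ContinuousLinearMap.coe_coe] at he
    rw [he] at hvw
    have h1 := planeProj_image_mem_nhds
      ((ContinuousLinearMap.snd ℝ V V).hasStrictFDerivAt.comp u hd)
      (Eventually.of_forall fun z => (h.mem _).2) (v := A.symm v) (w := A.symm w) (by
        simp only [ContinuousLinearMap.comp_apply, hA, A.apply_symm_apply]
        exact hvw) univ_mem
    refine Filter.mem_of_superset h1 ?_
    rintro _ ⟨z, -, rfl⟩
    exact ⟨_, rfl⟩
  have := key (chartAt E2 p p) (mem_chart_target E2 p)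
  rwa [(chartAt E2 p).left_inv (mem_chart_source E2 p)] at this

/-- Immersions whose components induce the same metric are congruent to the diagonal. -/
lemma exists_isOpenPartOfDiagonal [ConnectedSpace S] (h : IsLagrangianImmersion Φ)
    (hiso : ∀ p, ∀ u v : E2, mink (diffE2 Φ p u).1 (diffE2 Φ p v).1 =
      mink (diffE2 Φ p u).2 (diffE2 Φ p v).2)
    (h0 : ∀ p, ∃ u v : E2, omegaH (-1) (Φ p).1 (diffE2 Φ p u).1 (diffE2 Φ p v).1 ≠ 0) :
    ∃ T : W →ₗ[ℝ] W, IsHolomorphicIsometry T ∧ IsOpenPartOfDiagonal (T '' range Φ) := by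
  obtain ⟨L, hL, hΦL⟩ := h.exists_linear_isometry hiso
  set A := LinearMap.toMatrix' (L : V →ₗ[ℝ] V) with hA
  have hAL : ∀ x, A.mulVec x = L x := fun x => by
    rw [hA, LinearMap.toMatrix'_mulVec]; rfl
  have hAm : ∀ a b : V, mink (A.mulVec a) (A.mulVec b) = mink a b := fun a b => by
    rw [hAL, hAL, hL]
  obtain ⟨p₀⟩ := (inferInstance : Nonempty S)
  have hAo : IsOrthochronous A := isOrthochronous_of_mem hAm (h.mem p₀).1
    (by rw [hAL, ← hΦL]; exact (h.mem p₀).2)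
  have hLd : ∀ v : E2, (diffE2 Φ p₀ v).2 = L (diffE2 Φ p₀ v).1 := fun v => by
    have := clm_diff_eq_zero h.smooth (ContinuousLinearMap.snd ℝ V V -
      L.comp (ContinuousLinearMap.fst ℝ V V)) (p := p₀)
      (Eventually.of_forall fun q => by simp [hΦL q]) v
    exact sub_eq_zero.1 this
  -- The Lagrangian condition fixes the orientation: passing from the first component to the second
  -- multiplies the pulled back form by det A, yet both forms agree and are nonzero at `p₀`.
  have hdet : A.det = 1 := by
    obtain ⟨u, v, huv⟩ := h0 p₀
    have h1 : omegaH (-1) (Φ p₀).1 (diffE2 Φ p₀ u).1 (diffE2 Φ p₀ v).1 =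
        omegaH (-1) (Φ p₀).2 (diffE2 Φ p₀ u).2 (diffE2 Φ p₀ v).2 := (h.lagPlane p₀).omega_eq u v
    rw [hLd, hLd, hΦL, ← hAL, ← hAL, ← hAL, omegaH_eq, omegaH_eq, mink_cross_mulVec] at h1
    rw [omegaH_eq] at huv
    exact mul_right_cancel₀ huv (by rw [one_mul]; exact h1.symm)
  refine ⟨A.mulVecLin.prodMap LinearMap.id, ⟨⟨A, 1, hAo, isOrthochronous_one, Or.inl fun x => ?_⟩,
    fun x _ v _ => ?_⟩, ?_⟩
  · simp
  · simp only [JHH, JH, LinearMap.prodMap_apply, Matrix.mulVecLin_apply, LinearMap.id_apply,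
      cross_mulVec hAm hdet, Matrix.mulVec_smul]
  -- A point x of `H2 (-1 / 2)` is admitted when x/√2 has the same last two coordinates as some
  -- φ₂(p); by `planeProj_injOn` it then equals φ₂(p).
  · refine ⟨(fun x => planeProj ((1 / Real.sqrt 2) • x)) ⁻¹' range fun p => planeProj (Φ p).2,
      (h.isOpen_range_planeProj_snd h0).preimage (by fun_prop), ?_⟩
    have hs : (1 / Real.sqrt 2) * Real.sqrt 2 = 1 := by field_simp
    ext y
    constructor
    · rintro ⟨_, ⟨p, rfl⟩, rfl⟩
      refine ⟨Real.sqrt 2 • (Φ p).2, ⟨⟨p, ?_⟩, ?_⟩, ?_⟩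
      · simp only [smul_smul, hs, one_smul]
      · rw [← smul_mem_H2_iff, smul_smul, hs, one_smul]; exact (h.mem p).2
      · simp only [diagonal, Prod.smul_mk, smul_smul, hs, one_smul, LinearMap.prodMap_apply,
          Matrix.mulVecLin_apply, LinearMap.id_apply, hAL, ← hΦL]
    · rintro ⟨x, ⟨⟨p, hp⟩, hx⟩, rfl⟩
      refine ⟨Φ p, ⟨p, rfl⟩, ?_⟩
      have := planeProj_injOn (h.mem p).2 ((smul_mem_H2_iff x).2 hx) hp
      simp only [diagonal, Prod.smul_mk, LinearMap.prodMap_apply,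
          Matrix.mulVecLin_apply, LinearMap.id_apply, hAL, ← hΦL, this]

end IsLagrangianImmersion

end Surface

end LagHH

end

/-! ### Assembly of the pointwise and local results -/

open LagHH
theorem mainTheorem1 {S : Type*} [TopologicalSpace S]
    [ChartedSpace (EuclideanSpace ℝ (Fin 2)) S]
    [IsManifold 𝓘(ℝ, EuclideanSpace ℝ (Fin 2)) ∞ S] [ConnectedSpace S]
    (Φ : S → W) (hΦ : IsLagrangianImmersion Φ)
    (area : ∀ p : S, (Tan p) [⋀^Fin 2]→ₗ[ℝ] ℝ) (harea : IsCompatibleAreaForm Φ area) :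
    (∃! Γ : S → ℝ, IsGamma Φ area Γ) ∧
    ∀ Γ : S → ℝ, IsGamma Φ area Γ →
      (∀ p, 0 ≤ Γ p ^ 2 ∧ Γ p ^ 2 ≤ 1 / 4) ∧
      ((∀ p, Γ p ^ 2 = 0) ↔
        ∀ p, ∃ U : Set S, IsOpen U ∧ p ∈ U ∧ IsProductOfCurves (Φ '' U)) ∧
      ((∃ M : Set W, IsProductOfCurves M ∧ Set.range Φ ⊆ M) → ∀ p, Γ p ^ 2 = 0) ∧
      ((∀ p, Γ p ^ 2 = 1 / 4) ↔
        ∃ T : W →ₗ[ℝ] W, (IsHolomorphicIsometry T ∨ IsAntiholomorphicIsometry T) ∧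
          IsOpenPartOfDiagonal (T '' Set.range Φ)) := by
  have hP := hΦ.lagPlane
  have hiff : ∀ Γ : S → ℝ, IsGamma Φ area Γ ↔ ∀ p, ∀ u v : Tan p,
      omegaH (-1) (Φ p).1 (diff Φ p u).1 (diff Φ p v).1 = Γ p * area p ![u, v] := by
    intro Γ
    refine forall_congr' fun p => forall_congr' fun u => forall_congr' fun v => ?_
    have e₁ : ∀ v : Tan p, diff (fun q => (Φ q).1) p v = (diff Φ p v).1 := hΦ.diff_fst p
    have e₂ : ∀ v : Tan p, diff (fun q => (Φ q).2) p v = (diff Φ p v).2 := hΦ.diff_snd p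
    simp only [pullbackOmega, e₁, e₂]
    have h1 : omegaH (-1) (Φ p).1 (diff Φ p u).1 (diff Φ p v).1 =
      omegaH (-1) (Φ p).2 (diff Φ p u).2 (diff Φ p v).2 := (hP p).omega_eq u v
    rw [← h1, and_self]
  have hzero : ∀ Γ : S → ℝ, IsGamma Φ area Γ → ∀ p, Γ p ^ 2 = 0 ↔ ∀ u v : Tan p,
      omegaH (-1) (Φ p).1 (diff Φ p u).1 (diff Φ p v).1 = 0 := fun Γ hΓ p =>
    (hP p).gamma_eq_zero_iff (harea p) ((hiff Γ).1 hΓ p)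
  have hquarter : ∀ Γ : S → ℝ, IsGamma Φ area Γ → ∀ p, Γ p ^ 2 = 1 / 4 ↔ ∀ u v : Tan p,
      mink (diff Φ p u).1 (diff Φ p v).1 = mink (diff Φ p u).2 (diff Φ p v).2 := fun Γ hΓ p =>
    (hP p).gamma_eq_quarter_iff (harea p) ((hiff Γ).1 hΓ p)
  refine ⟨?_, fun Γ hΓ => ⟨fun p => ⟨sq_nonneg _, ?_⟩, ⟨fun h => ?_, fun h p => ?_⟩, ?_,
    fun h => ?_, ?_⟩⟩
  · choose Γ hΓ using fun p => ((hP p).exists_gamma (harea p)).2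
    refine ⟨Γ, (hiff Γ).2 hΓ, fun Γ' hΓ' => funext fun p => ?_⟩
    obtain ⟨u, v, huv⟩ := ((hP p).exists_gamma (harea p)).1
    exact mul_right_cancel₀ huv (((hiff Γ').1 hΓ' p u v).symm.trans (hΓ p u v))
  · exact (hP p).gamma_sq_le (harea p) ((hiff Γ).1 hΓ p)
  · exact hΦ.exists_nhds_isProductOfCurves fun p => (hzero Γ hΓ p).1 (h p)
  · obtain ⟨U, hU, hpU, hM⟩ := h p
    exact (hzero Γ hΓ p).2 (hΦ.omega_eq_zero_of_subset hM hU subset_rfl hpU)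
  · rintro ⟨M, hM, hsub⟩ p
    exact (hzero Γ hΓ p).2
      (hΦ.omega_eq_zero_of_subset hM isOpen_univ (by rwa [Set.image_univ]) (Set.mem_univ p))
  · obtain ⟨T, hT, hd⟩ := hΦ.exists_isOpenPartOfDiagonal
      (fun p => (hquarter Γ hΓ p).1 (h p)) fun p => by
        -- The pulled back form vanishes nowhere, as Γ² = 1/4 is not 0.
        by_contra! h0
        have := (hzero Γ hΓ p).2 h0
        rw [h p] at this
        norm_num at this
    exact ⟨T, Or.inl hT, hd⟩
  · rintro ⟨T, hT, hd⟩ p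
    exact (hquarter Γ hΓ p).2
      (hΦ.mink_eq_of_isOpenPartOfDiagonal (hT.elim (fun h => h.1) fun h => h.1) hd p)
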